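/- Let $M$ be the complement of the figure-eight knot in $S^3$, with $$\pi_1(M)=\langle \alpha,\beta \mid \beta^{-1}\alpha^{-1}\beta\alpha\beta^{-1}\alpha\beta\alpha^{-1}\beta^{-1}\alpha\rangle,$$ where $\alpha$ is the meridian and $\lambda=\beta^{-1}\alpha\beta\alpha^{-1}\alpha^{-1}\beta\alpha\beta^{-1}$ is the longitude, so that $\alpha$ and $\lambda$ commute and represent a basis of $H_1(\partial M,\mathbb{Z})$. Let $X(M)$ be the variety of characters of representations $\pi_1(M)\to SL_2(\mathbb{C})$; for $g\in\pi_1(M)$ put $I_g(\chi)=\chi(g)$ and $f_g=I_g^2-4$. The functions $I_g$ generate the coordinate ring of $X(M)$. Then $X(M)$ has exactly one irreducible component $X_0$ that contains the character of an irreducible representation, and $X_0$ is also the only irreducible component that contains the character of a lift to $SL_2(\mathbb{C})$ of a discrete faithful representation $\pi_1(M)\to PSL_2(\mathbb{C})$. Let $\widetilde{X_0}$ be the smooth projective model of the curve $X_0$, whose points are the normalized discrete valuations, trivial on $\mathbb{C}$, of the function field $\mathbb{C}(X_0)$; a point of $\widetilde{X_0}$ is ideal if some regular function on $X_0$ has a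 pole there. There are exactly two ideal points, and at each of them $f_\alpha$ has a pole of order $2$ and $f_\lambda$ has a pole of order $8$. For all integers $p,q$ and $\gamma=p\alpha+q\lambda\in H_1(\partial M,\mathbb{Z})$, the Culler–Shalen norm $|\gamma|$, that is, the degree of the rational function $f_\gamma=f_{\alpha^p\lambda^q}$ on $\widetilde{X_0}$ (the number of its poles, counted with multiplicity; $0$ if $\gamma=0$), is $$|\gamma|=2\bigl(|p+4q|+|p-4q|\bigr).$$ -/

import Mathlib

open Matrix WithZero

noncomputable section

/-! ### Characters of a group in `SL₂(ℂ)` -/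

namespace CharVar

variable {G : Type} [Group G]

/-- The group `SL₂(ℂ)`. -/
abbrev SL2C : Type := Matrix.SpecialLinearGroup (Fin 2) ℂ

/-- The character `g ↦ tr ρ(g)` of a representation `ρ : G → SL₂(ℂ)`. -/
def character (ρ : G →* SL2C) : G → ℂ :=
  fun g => Matrix.trace (ρ g : Matrix (Fin 2) (Fin 2) ℂ)

variable (G) in
/-- The `SL₂(ℂ)`-character variety `X(G)`, as the set of all characters. -/
def characterVariety : Set (G → ℂ) :=
  Set.range (character (G := G))

/-- `ρ` is irreducible: no line of `ℂ²` is invariant. -/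
def IsIrreducibleRep (ρ : G →* SL2C) : Prop :=
  ∀ v : Fin 2 → ℂ, v ≠ 0 →
    ∃ g : G, ∀ c : ℂ, (ρ g : Matrix (Fin 2) (Fin 2) ℂ) *ᵥ v ≠ c • v

/-- `ρ` is a lift to `SL₂(ℂ)` of a discrete faithful representation in
`PSL₂(ℂ) = SL₂(ℂ) / center`.  Since the center is finite, discreteness of the image in `PSL₂(ℂ)`
is the same as discreteness of `ρ(G)` in `SL₂(ℂ)`. -/
def IsDiscreteFaithful (ρ : G →* SL2C) : Prop :=
  Function.Injective ((QuotientGroup.mk' (Subgroup.center SL2C)).comp ρ) ∧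
    DiscreteTopology ρ.range

/-- The function `I_g(χ) = χ(g)` on a set `S` of characters. -/
def evalFun (S : Set (G → ℂ)) (g : G) : S → ℂ :=
  fun χ => χ.1 g

/-- The ring `ℂ[S]` of regular functions on a set `S` of characters: the `ℂ`-algebra of functions
on `S` generated by the `I_g`, `g ∈ G`. -/
abbrev coordRing (S : Set (G → ℂ)) : Subalgebra ℂ (S → ℂ) :=
  Algebra.adjoin ℂ (Set.range (evalFun S))

/-- `I_g` as a regular function on `S`. -/
def regFun (S : Set (G → ℂ)) (g : G) : coordRing S :=
  ⟨evalFun S g, Algebra.subset_adjoin ⟨g, rfl⟩⟩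

/-- `S` is irreducible for the Zariski topology: `ℂ[S]` is an integral domain
(in particular `S` is not empty). -/
def IsIrreducibleSet (S : Set (G → ℂ)) : Prop :=
  IsDomain (coordRing S)

/-- `S` is an irreducible component of the character variety of `G`: a maximal irreducible
subset. -/
def IsComponent (S : Set (G → ℂ)) : Prop :=
  Maximal (fun T : Set (G → ℂ) => T ⊆ characterVariety G ∧ IsIrreducibleSet T) S

/-- The field of rational functions `ℂ(S)` (a field when `S` is irreducible). -/
abbrev funField (S : Set (G → ℂ)) : Type :=
  FractionRing (coordRing S)

/-- The rational function `I_g` on `S`. -/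
def traceFun (S : Set (G → ℂ)) (g : G) : funField S :=
  algebraMap (coordRing S) (funField S) (regFun S g)

/-- The rational function `f_g = I_g² - 4` on `S`. -/
def fFun (S : Set (G → ℂ)) (g : G) : funField S :=
  traceFun S g ^ 2 - 4

/-- A place of `K` over `ℂ`: a normalized discrete valuation of `K`, trivial on `ℂ`.  When `K` is
the function field of a curve, the places are the points of the smooth projective model of the
curve. The valuation is written multiplicatively: `v f = exp (- ord f)`. -/
structure Place (K : Type) [CommRing K] [Algebra ℂ K] where
  /-- The valuation. -/
  v : Valuation K ℤᵐ⁰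
  surj : Function.Surjective v
  trivial_const : ∀ c : ℂ, c ≠ 0 → v (algebraMap ℂ K c) = 1

/-- The order of the pole of `f` at the place `P` (it is `0` if `f` is regular at `P`). -/
def Place.poleOrder {K : Type} [CommRing K] [Algebra ℂ K] (P : Place K) (f : K) : ℕ :=
  (WithZero.log (P.v f)).toNat

/-- The degree of the map to `ℂℙ¹` that is defined by the rational function `f`: the number of its
poles, counted with multiplicity. -/
def degree {K : Type} [CommRing K] [Algebra ℂ K] (f : K) : ℕ∞ :=
  ∑' P : Place K, (P.poleOrder f : ℕ∞)

/-- A point of the smooth projective model of the curve `S` is an ideal point if it does not lie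
over a point of `S`, that is, if some regular function on `S` has a pole there. -/
def IsIdealPoint (S : Set (G → ℂ)) (P : Place (funField S)) : Prop :=
  ∃ h : coordRing S, 1 < P.v (algebraMap (coordRing S) (funField S) h)

end CharVar

/-! ### The group of the figure-eight knot -/

namespace FigEight

/-- The relator `b⁻¹ a⁻¹ b a b⁻¹ a b a⁻¹ b⁻¹ a`. -/
def relator : FreeGroup (Fin 2) :=
  let a : FreeGroup (Fin 2) := FreeGroup.of 0
  let b : FreeGroup (Fin 2) := FreeGroup.of 1
  b⁻¹ * a⁻¹ * b * a * b⁻¹ * a * b * a⁻¹ * b⁻¹ * a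

/-- The fundamental group of the complement of the figure-eight knot. -/
abbrev KnotGroup : Type := PresentedGroup {relator}

/-- The generator `α`, which is the meridian. -/
def α : KnotGroup := PresentedGroup.of 0

/-- The generator `β`, a second meridian. -/
def β : KnotGroup := PresentedGroup.of 1

/-- The longitude. -/
def longitude : KnotGroup :=
  β⁻¹ * α * β * α⁻¹ * α⁻¹ * β * α * β⁻¹

theorem relation : β⁻¹ * α⁻¹ * β * α * β⁻¹ * α * β * α⁻¹ * β⁻¹ * α = 1 :=
  PresentedGroup.one_of_mem (rels := {relator}) (Set.mem_singleton relator)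

/-- The meridian and the longitude commute. -/
theorem commute_meridian_longitude : Commute α longitude := by
  have hr := relation
  have h1 : (α⁻¹ * β * α * β⁻¹) * α * (α⁻¹ * β * α * β⁻¹)⁻¹ = β := by
    calc (α⁻¹ * β * α * β⁻¹) * α * (α⁻¹ * β * α * β⁻¹)⁻¹
        = β * (β⁻¹ * α⁻¹ * β * α * β⁻¹ * α * β * α⁻¹ * β⁻¹ * α) := by
          simp [mul_assoc]
      _ = β := by rw [hr, mul_one]
  have h2 : (α * β⁻¹ * α⁻¹ * β) * α * (α * β⁻¹ * α⁻¹ * β)⁻¹ = β := by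
    calc (α * β⁻¹ * α⁻¹ * β) * α * (α * β⁻¹ * α⁻¹ * β)⁻¹
        = α * (β⁻¹ * α⁻¹ * β * α * β⁻¹ * α * β * α⁻¹ * β⁻¹ * α) * α⁻¹ * β := by
          simp [mul_assoc]
      _ = β := by rw [hr, mul_one, mul_inv_cancel, one_mul]
  have hl : longitude = (α * β⁻¹ * α⁻¹ * β)⁻¹ * (α⁻¹ * β * α * β⁻¹) := by
    simp [longitude, mul_assoc]
  have h3 : longitude * α * longitude⁻¹ = α := by
    rw [hl]
    generalize α⁻¹ * β * α * β⁻¹ = d at h1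
    generalize α * β⁻¹ * α⁻¹ * β = t at h2
    calc t⁻¹ * d * α * (t⁻¹ * d)⁻¹ = t⁻¹ * (d * α * d⁻¹) * t := by simp [mul_assoc]
      _ = t⁻¹ * (t * α * t⁻¹) * t := by rw [h1, h2]
      _ = α := by simp [mul_assoc]
  exact (mul_inv_eq_iff_eq_mul.mp h3).symm

/-- The element of the knot group given by the class `pα + qλ` in the first homology of the
boundary torus (whose fundamental group is abelian, generated by `α` and `λ`). -/
def peripheral (p q : ℤ) : KnotGroup :=
  α ^ p * longitude ^ q

/-- The Culler–Shalen norm of the class `pα + qλ` with respect to the curve of characters `S`: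
the degree of `f_{pα + qλ}` on the smooth projective model of `S`. -/
def csNorm (S : Set (KnotGroup → ℂ)) (p q : ℤ) : ℕ∞ :=
  CharVar.degree (CharVar.fFun S (peripheral p q))

end FigEight

end

open CharVar FigEight

/-! Put x = tr ρ(α) and u = tr ρ(αβ⁻¹) - 1. By Cayley–Hamilton every ρ(g) is a combination of 1,
ρ(α), ρ(β), ρ(αβ) with coefficients polynomial in x and u, so x and u generate the coordinate ring.
Riley's identity (`riley_identity`) turns the knot relation into (u² + 3u + 1 - ux²)(ρ(α) - ρ(β)) =
0. Hence each character satisfies u = 1, which is the reducible case, or lies on the curve ux² = u²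
+ 3u + 1. Every point of the curve is realised by a representation. The curve is irreducible, so it
is the component X₀. A faithful representation is irreducible because the second derived group of
the knot group is not trivial.

On the curve u is a unit with inverse x² - 3 - u, and (x, u) ↦ (x, u⁻¹) is an involution. If v(u) =
1, then x is also integral, so ideal places are those with v(u) ≠ 1. If v(u) < 1, then u has twice
the order of x⁻¹. Up to a power of u, a regular function is p(u) + x q(u); its two terms have orders
of different parity, so no cancellation occurs and v(f) is a power of v(x) that does not depend on
v. Normalization then leaves at most one such place (`place_unique`), and the involution handles
v(u) > 1.

Existence and pole orders come from explicit expansions in ℂ((t)) with meridian eigenvalue M = t⁻¹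
and a longitude eigenvalue L of order 4 or -4. Trace recurrences give I_γ = z + z⁻¹ with z = M^p
L^q, so f_γ = (z - z⁻¹)² has a pole of order 2|p ± 4q|. Elsewhere f_γ is regular, and the degree is
the sum over the two ideal points. -/

open CharVar FigEight
open scoped commutatorElement

/-! ### The algebra generated by two unimodular matrices with the same trace -/

namespace FigEight

/-- The combination `p₀ + p₁ A + p₂ B + p₃ A B`. -/
def wordComb {R : Type} [CommRing R] (A B : Matrix (Fin 2) (Fin 2) R) (p₀ p₁ p₂ p₃ : R) :
    Matrix (Fin 2) (Fin 2) R :=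
  p₀ • 1 + p₁ • A + p₂ • B + p₃ • (A * B)

/-- `A` and `B` have determinant `1` and trace `x`, and `tr (A B⁻¹) = u + 1`. -/
structure IsTracePair {R : Type} [CommRing R] (A B : Matrix (Fin 2) (Fin 2) R) (x u : R) : Prop where
  det_left : A.det = 1
  det_right : B.det = 1
  trace_left : A.trace = x
  trace_right : B.trace = x
  trace_mul : (A * B).trace = x ^ 2 - u - 1

namespace IsTracePair

variable {R : Type} [CommRing R] {A B : Matrix (Fin 2) (Fin 2) R} {x u : R}

theorem mul_left_self (h : IsTracePair A B x u) : A * A = x • A - 1 := by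
  obtain ⟨hA, hB, tA, tB, tAB⟩ := h
  simp only [det_fin_two, trace_fin_two] at *
  ext i j
  fin_cases i <;> fin_cases j <;> simp [Matrix.mul_apply, Fin.sum_univ_two] <;> subst tA
  · linear_combination -hA
  · ring
  · ring
  · linear_combination -hA

theorem mul_right_self (h : IsTracePair A B x u) : B * B = x • B - 1 :=
  mul_left_self (A := B) (B := A) (u := u)
    ⟨h.det_right, h.det_left, h.trace_right, h.trace_left, by rw [trace_mul_comm, h.trace_mul]⟩

/-- Polarized Cayley–Hamilton: AB + BA = tr(B) A + tr(A) B - (tr A tr B - tr AB). -/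
theorem mul_swap (h : IsTracePair A B x u) :
    B * A = x • A + x • B - A * B - (u + 1) • 1 := by
  obtain ⟨hA, hB, tA, tB, tAB⟩ := h
  simp only [det_fin_two, trace_fin_two, Matrix.mul_apply, Fin.sum_univ_two] at *
  ext i j
  fin_cases i <;> fin_cases j <;> simp [Matrix.mul_apply, Fin.sum_univ_two]
  · linear_combination tAB - B 1 1 * tA - (x - A 0 0) * tB
  · linear_combination B 0 1 * tA + A 0 1 * tB
  · linear_combination B 1 0 * tA + A 1 0 * tB
  · linear_combination tAB - B 0 0 * tA - (x - A 1 1) * tB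

/-- This and the next three lemmas give the right action of the letters A, B, A⁻¹, B⁻¹ on the basis
1, A, B, AB, so that any word can be reduced letter by letter. By Cayley–Hamilton the inverses are x
- A and x - B. -/
theorem wordComb_mul_left (h : IsTracePair A B x u) (p₀ p₁ p₂ p₃ : R) :
    wordComb A B p₀ p₁ p₂ p₃ * A = wordComb A B (-p₁ - (u + 1) * p₂ - x * p₃)
      (p₀ + x * p₁ + x * p₂ + (x ^ 2 - u - 1) * p₃) (x * p₂ + p₃) (-p₂) := by
  have h3 : A * B * A = B + (x ^ 2 - u - 1) • A - x • 1 := by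
    rw [mul_assoc, h.mul_swap]
    simp only [mul_add, mul_sub, mul_smul_comm, ← mul_assoc, h.mul_left_self, mul_one, sub_mul,
      smul_mul_assoc, one_mul]
    module
  simp only [wordComb, add_mul, smul_mul_assoc, one_mul, h3, h.mul_left_self, h.mul_swap]
  module

theorem wordComb_mul_right (h : IsTracePair A B x u) (p₀ p₁ p₂ p₃ : R) :
    wordComb A B p₀ p₁ p₂ p₃ * B =
      wordComb A B (-p₂) (-p₃) (p₀ + x * p₂) (p₁ + x * p₃) := by
  simp only [wordComb, add_mul, smul_mul_assoc, one_mul, mul_assoc, h.mul_right_self, mul_sub,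
    mul_one, mul_smul_comm]
  module

theorem wordComb_mul_left_inv (h : IsTracePair A B x u) (p₀ p₁ p₂ p₃ : R) :
    wordComb A B p₀ p₁ p₂ p₃ * (x • 1 - A) = wordComb A B (x * p₀ + p₁ + (u + 1) * p₂ + x * p₃)
      (-p₀ - x * p₂ - (x ^ 2 - u - 1) * p₃) (-p₃) (x * p₃ + p₂) := by
  rw [mul_sub, h.wordComb_mul_left, mul_smul_comm, mul_one]
  simp only [wordComb]
  module

theorem wordComb_mul_right_inv (h : IsTracePair A B x u) (p₀ p₁ p₂ p₃ : R) :
    wordComb A B p₀ p₁ p₂ p₃ * (x • 1 - B) =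
      wordComb A B (x * p₀ + p₂) (x * p₁ + p₃) (-p₀) (-p₁) := by
  rw [mul_sub, h.wordComb_mul_right, mul_smul_comm, mul_one]
  simp only [wordComb]
  module

theorem trace_wordComb (h : IsTracePair A B x u) (p₀ p₁ p₂ p₃ : R) :
    (wordComb A B p₀ p₁ p₂ p₃).trace =
      2 * p₀ + x * p₁ + x * p₂ + (x ^ 2 - u - 1) * p₃ := by
  simp only [wordComb, trace_add, trace_smul, h.trace_left, h.trace_right, h.trace_mul,
    trace_one, Fintype.card_fin, smul_eq_mul, Nat.cast_ofNat]
  ring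

theorem one_eq_wordComb : (1 : Matrix (Fin 2) (Fin 2) R) = wordComb A B 1 0 0 0 := by
  simp [wordComb]

/-- Riley's identity. -/
theorem riley_identity (h : IsTracePair A B x u) :
    1 * (x • 1 - A) * B * A * (x • 1 - B) * A - 1 * B * (x • 1 - A) * B * A * (x • 1 - B) =
      (u ^ 2 + 3 * u + 1 - u * x ^ 2) • (A - B) := by
  -- The inverses become opaque letters, so that rewriting the matrix 1 affects only the leading
  -- factor of each word and not the 1 inside x • 1 - A.
  have hA := h.wordComb_mul_left_inv
  have hB := h.wordComb_mul_right_inv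
  generalize x • 1 - A = A' at *
  generalize x • 1 - B = B' at *
  rw [one_eq_wordComb (A := A) (B := B)]
  simp only [h.wordComb_mul_left, h.wordComb_mul_right, hA, hB]
  simp only [wordComb]
  module

theorem trace_longitude (h : IsTracePair A B x u) (hF : u * x ^ 2 = u ^ 2 + 3 * u + 1) :
    (1 * (x • 1 - B) * A * B * (x • 1 - A) * (x • 1 - A) * B * A * (x • 1 - B)).trace =
      x ^ 4 - 5 * x ^ 2 + 2 := by
  have hA := h.wordComb_mul_left_inv
  have hB := h.wordComb_mul_right_inv
  generalize x • 1 - A = A' at *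
  generalize x • 1 - B = B' at *
  rw [one_eq_wordComb (A := A) (B := B)]
  simp only [h.wordComb_mul_left, h.wordComb_mul_right, hA, hB, h.trace_wordComb]
  linear_combination (x ^ 2 * u - 2 * x ^ 2) * hF

/-- The traces of α and λ determine M and L only up to separate inversion; the trace of αλ matches L
with M. -/
theorem trace_meridian_longitude (h : IsTracePair A B x u)
    (hF : u * x ^ 2 = u ^ 2 + 3 * u + 1) :
    (1 * A * (x • 1 - B) * A * B * (x • 1 - A) * (x • 1 - A) * B * A * (x • 1 - B)).trace =
      x ^ 3 + x * u ^ 2 - x * u - 4 * x := by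
  have hA := h.wordComb_mul_left_inv
  have hB := h.wordComb_mul_right_inv
  generalize x • 1 - A = A' at *
  generalize x • 1 - B = B' at *
  rw [one_eq_wordComb (A := A) (B := B)]
  simp only [h.wordComb_mul_left, h.wordComb_mul_right, hA, hB, h.trace_wordComb]
  linear_combination (x * u ^ 2 - 2 * x) * hF

end IsTracePair

end FigEight

/-! ### Representations of the figure-eight knot group -/

namespace CharVar

theorem SL2C.coe_inv_eq (A : SL2C) :
    ((A⁻¹ : SL2C) : Matrix (Fin 2) (Fin 2) ℂ) =
      (A : Matrix (Fin 2) (Fin 2) ℂ).trace • 1 - (A : Matrix (Fin 2) (Fin 2) ℂ) := by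
  rw [Matrix.SpecialLinearGroup.coe_inv, adjugate_fin_two, trace_fin_two]
  ext i j
  fin_cases i <;> fin_cases j <;> simp

variable {G : Type} [Group G]

theorem character_inv (ρ : G →* SL2C) (g : G) : character ρ g⁻¹ = character ρ g := by
  simp only [character, map_inv, SL2C.coe_inv_eq, trace_sub, trace_smul, trace_one]
  simp
  ring

theorem character_mul_add_mul_inv (ρ : G →* SL2C) (g h : G) :
    character ρ (g * h) + character ρ (g⁻¹ * h) = character ρ g * character ρ h := by
  simp only [character, map_inv, map_mul, Matrix.SpecialLinearGroup.coe_mul, SL2C.coe_inv_eq, sub_mul,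
    trace_sub, trace_smul, smul_mul_assoc, one_mul, smul_eq_mul]
  ring

theorem character_one (ρ : G →* SL2C) : character ρ 1 = 2 := by
  simp [character]

theorem character_conj (ρ : G →* SL2C) (g h : G) :
    character ρ (g * h * g⁻¹) = character ρ h := by
  have h1 : (((ρ g)⁻¹ : SL2C) : Matrix (Fin 2) (Fin 2) ℂ) * (ρ g : Matrix (Fin 2) (Fin 2) ℂ) = 1 := by
    rw [← Matrix.SpecialLinearGroup.coe_mul, inv_mul_cancel, Matrix.SpecialLinearGroup.coe_one]
  rw [character, character, map_mul, map_mul, map_inv, Matrix.SpecialLinearGroup.coe_mul, trace_mul_comm,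
    Matrix.SpecialLinearGroup.coe_mul, ← mul_assoc, h1, one_mul]

/-- A unimodular matrix with a nonzero fixed vector has trace `2`. -/
theorem trace_eq_two_of_fixed {A : SL2C} {v : Fin 2 → ℂ} (hv : v ≠ 0)
    (h : (A : Matrix (Fin 2) (Fin 2) ℂ) *ᵥ v = v) :
    (A : Matrix (Fin 2) (Fin 2) ℂ).trace = 2 := by
  have h0 : ((A : Matrix (Fin 2) (Fin 2) ℂ) - 1).det = 0 :=
    exists_mulVec_eq_zero_iff.mp ⟨v, hv, by rw [sub_mulVec, h, one_mulVec, sub_self]⟩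
  have h1 := A.det_coe
  rw [det_fin_two] at h0 h1
  simp only [Matrix.sub_apply, one_apply_eq, one_apply_ne (zero_ne_one' (Fin 2)),
    one_apply_ne (zero_ne_one' (Fin 2)).symm] at h0
  rw [trace_fin_two]
  linear_combination h1 - h0

/-- Unimodular matrices that fix the same nonzero vector commute. -/
theorem commute_of_fixed {A B : SL2C} {v : Fin 2 → ℂ} (hv : v ≠ 0)
    (hA : (A : Matrix (Fin 2) (Fin 2) ℂ) *ᵥ v = v) (hB : (B : Matrix (Fin 2) (Fin 2) ℂ) *ᵥ v = v) :
    A * B = B * A := by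
  have tA := trace_eq_two_of_fixed hv hA
  have tB := trace_eq_two_of_fixed hv hB
  rw [trace_fin_two] at tA tB
  have a0 := congrFun hA 0
  have a1 := congrFun hA 1
  have b0 := congrFun hB 0
  have b1 := congrFun hB 1
  simp only [mulVec, dotProduct, Fin.sum_univ_two] at a0 a1 b0 b1
  apply Subtype.ext
  rw [Matrix.SpecialLinearGroup.coe_mul, Matrix.SpecialLinearGroup.coe_mul]
  generalize (A : Matrix (Fin 2) (Fin 2) ℂ) = A at *
  generalize (B : Matrix (Fin 2) (Fin 2) ℂ) = B at *
  have hA1 : A 1 1 = 2 - A 0 0 := by linear_combination tA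
  have hB1 : B 1 1 = 2 - B 0 0 := by linear_combination tB
  rw [hA1] at a1
  rw [hB1] at b1
  have key : ∀ z : ℂ, v 0 * z = 0 → v 1 * z = 0 → z = 0 := by
    intro z h0 h1
    by_contra hz
    apply hv
    ext i
    fin_cases i
    · simpa [hz] using h0
    · simpa [hz] using h1
  -- A - 1 and B - 1 are traceless and kill the same vector, so they are proportional; `k1`, `k2`,
  -- `k3` are the vanishing minors that say so.
  have k1 : (A 0 0 - 1) * B 0 1 - (B 0 0 - 1) * A 0 1 = 0 := by
    apply key
    · linear_combination B 0 1 * a0 - A 0 1 * b0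
    · linear_combination (A 0 0 - 1) * b0 - (B 0 0 - 1) * a0
  have k2 : (A 0 0 - 1) * B 1 0 - (B 0 0 - 1) * A 1 0 = 0 := by
    apply key
    · linear_combination (A 0 0 - 1) * b1 - (B 0 0 - 1) * a1
    · linear_combination -B 1 0 * a1 + A 1 0 * b1
  have k3 : A 0 1 * B 1 0 - B 0 1 * A 1 0 = 0 := by
    apply key
    · linear_combination A 0 1 * b1 - B 0 1 * a1 - k1 * v 1
    · linear_combination B 1 0 * a0 - A 1 0 * b0 - k2 * v 0
  ext i j
  fin_cases i <;> fin_cases j <;> simp only [Matrix.mul_apply, Fin.sum_univ_two, Fin.zero_eta,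
    Fin.mk_one, Fin.isValue, hA1, hB1]
  · linear_combination k3
  · linear_combination 2 * k1
  · linear_combination -2 * k2
  · linear_combination -k3

theorem coe_mul_mulVec (ρ : G →* SL2C) (g h : G) (v : Fin 2 → ℂ) :
    (ρ (g * h) : Matrix (Fin 2) (Fin 2) ℂ) *ᵥ v =
      (ρ g : Matrix (Fin 2) (Fin 2) ℂ) *ᵥ (ρ h : Matrix (Fin 2) (Fin 2) ℂ) *ᵥ v := by
  rw [map_mul, Matrix.SpecialLinearGroup.coe_mul, mulVec_mulVec]

theorem mulVec_ne_zero (ρ : G →* SL2C) (g : G) {v : Fin 2 → ℂ} (hv : v ≠ 0) :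
    (ρ g : Matrix (Fin 2) (Fin 2) ℂ) *ᵥ v ≠ 0 := by
  intro h
  apply hv
  have := coe_mul_mulVec ρ g⁻¹ g v
  rwa [inv_mul_cancel, map_one, Matrix.SpecialLinearGroup.coe_one, one_mulVec, h, mulVec_zero] at this

/-- Commutators fix every common eigenvector. -/
theorem commutator_mulVec (ρ : G →* SL2C) {g h : G} {v : Fin 2 → ℂ} (hv : v ≠ 0) {c d : ℂ}
    (hg : (ρ g : Matrix (Fin 2) (Fin 2) ℂ) *ᵥ v = c • v)
    (hh : (ρ h : Matrix (Fin 2) (Fin 2) ℂ) *ᵥ v = d • v) :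
    (ρ ⁅g, h⁆ : Matrix (Fin 2) (Fin 2) ℂ) *ᵥ v = v := by
  have h1 : (ρ (h * g) : Matrix (Fin 2) (Fin 2) ℂ) *ᵥ v = (c * d) • v := by
    rw [coe_mul_mulVec, hg, mulVec_smul, hh, smul_smul]
  have h2 : (ρ (⁅g, h⁆ * (h * g)) : Matrix (Fin 2) (Fin 2) ℂ) *ᵥ v = (c * d) • v := by
    rw [show ⁅g, h⁆ * (h * g) = g * h by simp [commutatorElement_def, mul_assoc],
      coe_mul_mulVec, hh, mulVec_smul, hg, smul_smul, mul_comm]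
  have h3 : c * d ≠ 0 := by
    rintro h0
    rw [h0, zero_smul] at h1
    exact mulVec_ne_zero ρ _ hv h1
  rw [coe_mul_mulVec, h1, mulVec_smul] at h2
  exact smul_right_injective _ h3 h2

/-- A reducible representation kills the second commutators. -/
theorem map_commutator_commutator_of_reducible (ρ : G →* SL2C) (hρ : ¬ IsIrreducibleRep ρ)
    (a b c d : G) : ρ ⁅⁅a, b⁆, ⁅c, d⁆⁆ = 1 := by
  simp only [IsIrreducibleRep, not_forall, not_exists, not_not] at hρ
  obtain ⟨v, hv, h⟩ := hρ
  choose e he using h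
  rw [map_commutatorElement, commutatorElement_eq_one_iff_mul_comm]
  exact commute_of_fixed hv (commutator_mulVec ρ hv (he a) (he b))
    (commutator_mulVec ρ hv (he c) (he d))

/-- For invertible B this is Cayley–Hamilton for DB, multiplied on the right by B⁻¹. -/
theorem mul_mul_self_fin_two (D B : Matrix (Fin 2) (Fin 2) ℂ) :
    D * B * D = (D * B).trace • D - D.det • B.adjugate := by
  rw [adjugate_fin_two, trace_fin_two, det_fin_two]
  ext i j
  fin_cases i <;> fin_cases j <;> simp [Matrix.mul_apply, Fin.sum_univ_two] <;> ring

theorem exists_smul_of_mulVec_eq_zero {D : Matrix (Fin 2) (Fin 2) ℂ} (hD : D ≠ 0)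
    {v z : Fin 2 → ℂ} (hv : v ≠ 0) (hDv : D *ᵥ v = 0) (hDz : D *ᵥ z = 0) :
    ∃ c : ℂ, z = c • v := by
  have hvz : v 0 * z 1 - v 1 * z 0 = 0 := by
    by_contra hne
    apply hD
    ext i j
    have e1 := congrFun hDv i
    have e2 := congrFun hDz i
    simp only [mulVec, dotProduct, Fin.sum_univ_two, Pi.zero_apply] at e1 e2
    apply (mul_eq_zero.mp (_ : (v 0 * z 1 - v 1 * z 0) * D i j = 0)).resolve_left hne
    fin_cases j <;> simp only [Fin.zero_eta, Fin.mk_one, Fin.isValue]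
    · linear_combination z 1 * e1 - v 1 * e2
    · linear_combination v 0 * e2 - z 0 * e1
  by_cases h0 : v 0 = 0
  · have h1 : v 1 ≠ 0 := fun h1 => hv (by ext i; fin_cases i <;> simp [h0, h1])
    have hz : z 0 = 0 := by simpa [h0, h1] using hvz
    refine ⟨z 1 / v 1, ?_⟩
    ext i
    fin_cases i <;> simp [h0, h1, hz]
  · refine ⟨z 0 / v 0, ?_⟩
    ext i
    fin_cases i
    · simp [h0]
    · simp only [Fin.mk_one, Fin.isValue, Pi.smul_apply, smul_eq_mul]
      field_simp
      linear_combination hvz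

/-- Two unimodular matrices `A`, `B` with the same trace and `tr (A B⁻¹) = 2` have a common
eigenvector. -/
theorem exists_common_eigenvector {A B : Matrix (Fin 2) (Fin 2) ℂ} {x : ℂ}
    (h : FigEight.IsTracePair A B x 1) :
    ∃ v : Fin 2 → ℂ, v ≠ 0 ∧ (∃ c : ℂ, A *ᵥ v = c • v) ∧ ∃ c : ℂ, B *ᵥ v = c • v := by
  by_cases hAB : A = B
  · subst hAB
    obtain ⟨c, hc⟩ := Module.End.exists_eigenvalue (Matrix.toLin' A)
    obtain ⟨v, hv⟩ := hc.exists_hasEigenvector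
    have := hv.apply_eq_smul
    rw [Matrix.toLin'_apply] at this
    exact ⟨v, hv.2, ⟨c, this⟩, ⟨c, this⟩⟩
  obtain ⟨w, hw⟩ : ∃ w : Fin 2 → ℂ, (A - B) *ᵥ w ≠ 0 := by
    by_contra! hcon
    apply hAB
    rw [← sub_eq_zero]
    ext1 i j
    have := congrFun (hcon (Pi.single j 1)) i
    simpa using this
  -- With D = A - B, the vanishing of tr D, det D and tr(DB) gives D² = 0 and DBD = 0. Thus the
  -- image of D is a line inside ker D that B preserves, and A = B on it.
  have htr : (A - B).trace = 0 := by rw [trace_sub, h.trace_left, h.trace_right, sub_self]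
  have hdet : (A - B).det = 0 := by
    have hA := h.det_left
    have hB := h.det_right
    have tA := h.trace_left
    have tB := h.trace_right
    have tAB := h.trace_mul
    simp only [det_fin_two, trace_fin_two, Matrix.mul_apply, Fin.sum_univ_two,
      Matrix.sub_apply] at *
    linear_combination hA + hB + tAB - (B 0 0 + B 1 1) * tA - x * tB
  have htrB : ((A - B) * B).trace = 0 := by
    rw [sub_mul, trace_sub, h.trace_mul, h.mul_right_self, trace_sub, trace_smul, h.trace_right,
      trace_one]
    simp
    ring
  have h1 := mul_mul_self_fin_two (A - B) 1
  have h2 := mul_mul_self_fin_two (A - B) B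
  rw [mul_one, htr, hdet, zero_smul, zero_smul, sub_zero] at h1
  rw [htrB, hdet, zero_smul, zero_smul, sub_zero] at h2
  have hDv : (A - B) *ᵥ (A - B) *ᵥ w = 0 := by rw [mulVec_mulVec, h1, zero_mulVec]
  have hDBv : (A - B) *ᵥ B *ᵥ (A - B) *ᵥ w = 0 := by
    rw [mulVec_mulVec, mulVec_mulVec, h2, zero_mulVec]
  obtain ⟨c, hc⟩ := exists_smul_of_mulVec_eq_zero (sub_ne_zero.mpr hAB) hw hDv hDBv
  refine ⟨_, hw, ⟨c, ?_⟩, c, hc⟩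
  rw [← hc, ← sub_eq_zero, ← sub_mulVec, hDv]

end CharVar

/-! ### Characters of the knot group in the coordinates x and u -/

namespace FigEight

theorem conj_α_eq_β : (α⁻¹ * β * α * β⁻¹) * α * (α⁻¹ * β * α * β⁻¹)⁻¹ = β := by
  calc (α⁻¹ * β * α * β⁻¹) * α * (α⁻¹ * β * α * β⁻¹)⁻¹
      = β * (β⁻¹ * α⁻¹ * β * α * β⁻¹ * α * β * α⁻¹ * β⁻¹ * α) := by
        simp [mul_assoc]
    _ = β := by rw [relation, mul_one]

theorem closure_generators : Subgroup.closure {α, β} = (⊤ : Subgroup KnotGroup) := by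
  rw [← PresentedGroup.closure_range_of]
  congr 1
  ext g
  simp only [Set.mem_insert_iff, Set.mem_singleton_iff, Set.mem_range, Fin.exists_fin_two]
  exact or_congr eq_comm eq_comm

/-- The coordinate `x = tr ρ(α)` of a character. -/
def coordX (χ : KnotGroup → ℂ) : ℂ := χ α

/-- The coordinate `u = tr ρ(αβ⁻¹) - 1` of a character. -/
def coordU (χ : KnotGroup → ℂ) : ℂ := χ (α * β⁻¹) - 1

theorem character_β (ρ : KnotGroup →* SL2C) : character ρ β = character ρ α := by
  conv_lhs => rw [← conj_α_eq_β]
  exact character_conj ρ _ _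

theorem isTracePair (ρ : KnotGroup →* SL2C) :
    IsTracePair (ρ α : Matrix (Fin 2) (Fin 2) ℂ) (ρ β : Matrix (Fin 2) (Fin 2) ℂ)
      (coordX (character ρ)) (coordU (character ρ)) where
  det_left := (ρ α).2
  det_right := (ρ β).2
  trace_left := rfl
  trace_right := character_β ρ
  trace_mul := by
    have h := character_mul_add_mul_inv ρ β⁻¹ α
    have h1 : character ρ (α * β⁻¹) = character ρ (β⁻¹ * α) := by
      rw [← character_conj ρ α (β⁻¹ * α)]
      congr 1
      group
    have h2 : character ρ (α * β) = character ρ (β * α) := by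
      rw [← character_conj ρ α (β * α)]
      congr 1
      group
    rw [inv_inv, character_inv, character_β, ← h1, ← h2] at h
    rw [← Matrix.SpecialLinearGroup.coe_mul, ← map_mul]
    change character ρ (α * β) = character ρ α ^ 2 - (character ρ (α * β⁻¹) - 1) - 1
    linear_combination h

theorem coe_map_α_inv (ρ : KnotGroup →* SL2C) :
    (ρ α⁻¹ : Matrix (Fin 2) (Fin 2) ℂ) =
      coordX (character ρ) • 1 - (ρ α : Matrix (Fin 2) (Fin 2) ℂ) := by
  rw [map_inv, SL2C.coe_inv_eq]
  rfl

theorem coe_map_β_inv (ρ : KnotGroup →* SL2C) :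
    (ρ β⁻¹ : Matrix (Fin 2) (Fin 2) ℂ) =
      coordX (character ρ) • 1 - (ρ β : Matrix (Fin 2) (Fin 2) ℂ) := by
  rw [map_inv, SL2C.coe_inv_eq, (isTracePair ρ).trace_right]

/-- The equation of the curve of irreducible characters. -/
def OnCurve {R : Type} [CommRing R] (x u : R) : Prop :=
  u * x ^ 2 = u ^ 2 + 3 * u + 1

/-- The relation kills the left side of Riley's identity, so either the scalar vanishes or ρ(α) =
ρ(β), and then tr ρ(αβ⁻¹) = 2. -/
theorem coordU_eq_one_or_onCurve (ρ : KnotGroup →* SL2C) :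
    coordU (character ρ) = 1 ∨ OnCurve (coordX (character ρ)) (coordU (character ρ)) := by
  have h := (isTracePair ρ).riley_identity
  rw [← coe_map_α_inv, ← coe_map_β_inv, one_mul, one_mul] at h
  simp only [← Matrix.SpecialLinearGroup.coe_mul, ← map_mul] at h
  have hrel : α⁻¹ * β * α * β⁻¹ * α = β * α⁻¹ * β * α * β⁻¹ := by
    rw [mul_inv_eq_iff_eq_mul.mp conj_α_eq_β]
    simp only [mul_assoc]
  rw [hrel, sub_self] at h
  rcases smul_eq_zero.mp h.symm with h0 | h0
  · right
    rw [OnCurve]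
    linear_combination -h0
  · left
    have hαβ : ρ α = ρ β := Subtype.ext (sub_eq_zero.mp h0)
    rw [coordU, character, map_mul, map_inv, hαβ, mul_inv_cancel]
    simp
    norm_num

/-- The representation with given images of the generators. -/
theorem exists_rep {A B : SL2C} {x u : ℂ}
    (h : IsTracePair (A : Matrix (Fin 2) (Fin 2) ℂ) (B : Matrix (Fin 2) (Fin 2) ℂ) x u)
    (hF : OnCurve x u) :
    ∃ ρ : KnotGroup →* SL2C, coordX (character ρ) = x ∧ coordU (character ρ) = u := by
  have hA : ((A⁻¹ : SL2C) : Matrix (Fin 2) (Fin 2) ℂ) = x • 1 - (A : Matrix (Fin 2) (Fin 2) ℂ) := by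
    rw [SL2C.coe_inv_eq, h.trace_left]
  have hB : ((B⁻¹ : SL2C) : Matrix (Fin 2) (Fin 2) ℂ) = x • 1 - (B : Matrix (Fin 2) (Fin 2) ℂ) := by
    rw [SL2C.coe_inv_eq, h.trace_right]
  have h1 := h.riley_identity
  rw [← hA, ← hB, one_mul, one_mul, ← hF, sub_self, zero_smul, sub_eq_zero] at h1
  simp only [← Matrix.SpecialLinearGroup.coe_mul] at h1
  have h2 : A⁻¹ * B * A * B⁻¹ * A = B * A⁻¹ * B * A * B⁻¹ := Subtype.ext h1
  have h3 : ∀ r ∈ ({relator} : Set (FreeGroup (Fin 2))), FreeGroup.lift ![A, B] r = 1 := by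
    rintro r rfl
    simp only [relator, map_mul, map_inv, FreeGroup.lift_apply_of, Matrix.cons_val_zero,
      Matrix.cons_val_one]
    calc B⁻¹ * A⁻¹ * B * A * B⁻¹ * A * B * A⁻¹ * B⁻¹ * A
        = B⁻¹ * (A⁻¹ * B * A * B⁻¹ * A) * (B * A⁻¹ * B⁻¹ * A) := by simp only [mul_assoc]
      _ = 1 := by rw [h2]; simp [mul_assoc]
  have hα : PresentedGroup.toGroup h3 α = A := PresentedGroup.toGroup.of h3
  have hβ : PresentedGroup.toGroup h3 β = B := PresentedGroup.toGroup.of h3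
  refine ⟨PresentedGroup.toGroup h3, ?_, ?_⟩
  · rw [coordX, character, hα, h.trace_left]
  · rw [coordU, character, map_mul, map_inv, hα, hβ, Matrix.SpecialLinearGroup.coe_mul, hB,
      mul_sub, trace_sub, h.trace_mul, mul_smul_comm, mul_one, trace_smul, h.trace_left, smul_eq_mul]
    ring

theorem exists_rep_of_onCurve {x u : ℂ} (hF : OnCurve x u) :
    ∃ ρ : KnotGroup →* SL2C, coordX (character ρ) = x ∧ coordU (character ρ) = u := by
  obtain ⟨m, hm⟩ : ∃ m : ℂ, m ^ 2 - x * m + 1 = 0 := by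
    obtain ⟨s, hs⟩ := IsAlgClosed.exists_pow_nat_eq (x ^ 2 - 4) (n := 2) two_pos
    exact ⟨(x + s) / 2, by linear_combination hs / 4⟩
  -- Riley's normal form: m is an eigenvalue of the meridian, x - m = m⁻¹, and the entry 1 - u is
  -- forced by the trace of AB.
  let A : SL2C := ⟨!![m, 1; 0, x - m], by rw [det_fin_two_of]; linear_combination -hm⟩
  let B : SL2C := ⟨!![m, 0; 1 - u, x - m], by rw [det_fin_two_of]; linear_combination -hm⟩
  refine exists_rep (A := A) (B := B) ⟨A.2, B.2, ?_, ?_, ?_⟩ hF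
  · simp [A, trace_fin_two]
  · simp [B, trace_fin_two]
  · simp [A, B, trace_fin_two]
    linear_combination 2 * hm

/-- Since α and β are conjugate, αβ⁻¹ is a commutator; it fixes any invariant line pointwise, so its
trace is 2. Conversely, trace 2 gives the generators a common eigenvector. -/
theorem isIrreducibleRep_iff (ρ : KnotGroup →* SL2C) :
    IsIrreducibleRep ρ ↔ coordU (character ρ) ≠ 1 := by
  rw [← not_iff_not, not_not]
  constructor
  · intro h
    simp only [IsIrreducibleRep, not_forall, not_exists, not_not] at h
    obtain ⟨v, hv, h⟩ := h
    choose e he using h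
    have h1 : α * β⁻¹ = ⁅α, α⁻¹ * β * α * β⁻¹⁆ := by
      conv_lhs => rw [← conj_α_eq_β]
      rw [commutatorElement_def]
      group
    rw [coordU, character, h1, trace_eq_two_of_fixed hv (commutator_mulVec ρ hv (he _) (he _))]
    norm_num
  · intro h
    have h1 := isTracePair ρ
    rw [h] at h1
    obtain ⟨v, hv, hA, hB⟩ := exists_common_eigenvector h1
    have key : ∀ g : KnotGroup, ∃ c : ℂ, (ρ g : Matrix (Fin 2) (Fin 2) ℂ) *ᵥ v = c • v := by
      intro g
      have hg : g ∈ Subgroup.closure {α, β} := by rw [closure_generators]; trivial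
      induction hg using Subgroup.closure_induction with
      | mem g hg =>
        rcases hg with rfl | rfl
        · exact hA
        · exact hB
      | one => exact ⟨1, by simp⟩
      | mul g h _ _ hg hh =>
        obtain ⟨c, hc⟩ := hg
        obtain ⟨d, hd⟩ := hh
        exact ⟨d * c, by rw [coe_mul_mulVec, hd, mulVec_smul, hc, smul_smul]⟩
      | inv g _ hg =>
        obtain ⟨c, hc⟩ := hg
        refine ⟨(ρ g : Matrix (Fin 2) (Fin 2) ℂ).trace - c, ?_⟩
        rw [map_inv, SL2C.coe_inv_eq, sub_mulVec, hc, smul_mulVec, one_mulVec, sub_smul]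
    intro hirr
    obtain ⟨g, hg⟩ := hirr v hv
    obtain ⟨c, hc⟩ := key g
    exact hg c hc

/-- The second derived subgroup of the knot group is not trivial: the knot group has
non-metabelian permutation representations of degree `5`. -/
theorem commutator_commutator_ne_one : ⁅⁅α, β⁆, ⁅α⁻¹, β⁆⁆ ≠ 1 := by
  let a : Equiv.Perm (Fin 5) := ⟨![1, 0, 3, 4, 2], ![1, 0, 4, 2, 3], by decide, by decide⟩
  let b : Equiv.Perm (Fin 5) := ⟨![1, 2, 0, 4, 3], ![2, 0, 1, 4, 3], by decide, by decide⟩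
  have h3 : ∀ r ∈ ({relator} : Set (FreeGroup (Fin 2))), FreeGroup.lift ![a, b] r = 1 := by
    rintro r rfl
    simp only [relator, map_mul, map_inv, FreeGroup.lift_apply_of, Matrix.cons_val_zero,
      Matrix.cons_val_one]
    decide
  have hα : PresentedGroup.toGroup h3 α = a := PresentedGroup.toGroup.of h3
  have hβ : PresentedGroup.toGroup h3 β = b := PresentedGroup.toGroup.of h3
  intro h
  have h4 := congrArg (PresentedGroup.toGroup h3) h
  simp only [commutatorElement_def, map_mul, map_inv, hα, hβ, map_one] at h4
  revert h4
  decide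

theorem isIrreducibleRep_of_isDiscreteFaithful {ρ : KnotGroup →* SL2C} (h : IsDiscreteFaithful ρ) :
    IsIrreducibleRep ρ := by
  by_contra hρ
  have hinj : Function.Injective ρ := by
    have := h.1
    rw [MonoidHom.coe_comp] at this
    exact this.of_comp
  apply commutator_commutator_ne_one
  apply hinj
  rw [map_commutator_commutator_of_reducible ρ hρ, map_one]

/-- Every trace is a polynomial in the coordinates `x` and `u`. -/
theorem exists_trace_polynomial (g : KnotGroup) :
    ∃ P : MvPolynomial (Fin 2) ℂ, ∀ ρ : KnotGroup →* SL2C,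
      character ρ g = MvPolynomial.eval ![coordX (character ρ), coordU (character ρ)] P := by
  let Q : KnotGroup → Prop := fun g => ∃ p₀ p₁ p₂ p₃ : MvPolynomial (Fin 2) ℂ,
    ∀ ρ : KnotGroup →* SL2C, (ρ g : Matrix (Fin 2) (Fin 2) ℂ) =
      wordComb (ρ α : Matrix (Fin 2) (Fin 2) ℂ) (ρ β : Matrix (Fin 2) (Fin 2) ℂ)
        (MvPolynomial.eval ![coordX (character ρ), coordU (character ρ)] p₀)
        (MvPolynomial.eval ![coordX (character ρ), coordU (character ρ)] p₁)
        (MvPolynomial.eval ![coordX (character ρ), coordU (character ρ)] p₂)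
        (MvPolynomial.eval ![coordX (character ρ), coordU (character ρ)] p₃)
  have hone : Q 1 := ⟨1, 0, 0, 0, fun ρ => by simp [wordComb]⟩
  let X : MvPolynomial (Fin 2) ℂ := MvPolynomial.X 0
  let U : MvPolynomial (Fin 2) ℂ := MvPolynomial.X 1
  -- The induction carries an arbitrary left factor g because the reduction formulas describe right
  -- multiplication only.
  have key : ∀ h : KnotGroup, ∀ g : KnotGroup, Q g → Q (g * h) := by
    intro h
    have hh : h ∈ Subgroup.closure {α, β} := by rw [closure_generators]; trivial
    induction hh using Subgroup.closure_induction'' with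
    | one => intro g hg; rwa [mul_one]
    | mul h k _ _ hh hk => intro g hg; rw [← mul_assoc]; exact hk _ (hh _ hg)
    | mem h hh =>
      rintro g ⟨p₀, p₁, p₂, p₃, hp⟩
      rcases hh with rfl | rfl
      · refine ⟨-p₁ - (U + 1) * p₂ - X * p₃, p₀ + X * p₁ + X * p₂ + (X ^ 2 - U - 1) * p₃,
          X * p₂ + p₃, -p₂, fun ρ => ?_⟩
        rw [map_mul, Matrix.SpecialLinearGroup.coe_mul, hp ρ, (isTracePair ρ).wordComb_mul_left]
        simp [X, U]
      · refine ⟨-p₂, -p₃, p₀ + X * p₂, p₁ + X * p₃, fun ρ => ?_⟩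
        rw [map_mul, Matrix.SpecialLinearGroup.coe_mul, hp ρ, (isTracePair ρ).wordComb_mul_right]
        simp [X]
    | inv_mem h hh =>
      rintro g ⟨p₀, p₁, p₂, p₃, hp⟩
      rcases hh with rfl | rfl
      · refine ⟨X * p₀ + p₁ + (U + 1) * p₂ + X * p₃, -p₀ - X * p₂ - (X ^ 2 - U - 1) * p₃,
          -p₃, X * p₃ + p₂, fun ρ => ?_⟩
        rw [map_mul, Matrix.SpecialLinearGroup.coe_mul, hp ρ, coe_map_α_inv,
          (isTracePair ρ).wordComb_mul_left_inv]
        simp [X, U]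
      · refine ⟨X * p₀ + p₂, X * p₁ + p₃, -p₀, -p₁, fun ρ => ?_⟩
        rw [map_mul, Matrix.SpecialLinearGroup.coe_mul, hp ρ, coe_map_β_inv,
          (isTracePair ρ).wordComb_mul_right_inv]
        simp [X]
  obtain ⟨p₀, p₁, p₂, p₃, hp⟩ := key g 1 hone
  refine ⟨2 * p₀ + X * p₁ + X * p₂ + (X ^ 2 - U - 1) * p₃, fun ρ => ?_⟩
  have h1 := hp ρ
  rw [one_mul] at h1
  rw [character, h1, (isTracePair ρ).trace_wordComb]
  simp [X, U]

theorem character_longitude {ρ : KnotGroup →* SL2C}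
    (h : OnCurve (coordX (character ρ)) (coordU (character ρ))) :
    character ρ longitude = coordX (character ρ) ^ 4 - 5 * coordX (character ρ) ^ 2 + 2 := by
  have := (isTracePair ρ).trace_longitude h
  rw [← coe_map_α_inv, ← coe_map_β_inv, one_mul] at this
  simp only [← Matrix.SpecialLinearGroup.coe_mul, ← map_mul] at this
  exact this

theorem character_meridian_longitude {ρ : KnotGroup →* SL2C}
    (h : OnCurve (coordX (character ρ)) (coordU (character ρ))) :
    character ρ (α * longitude) = coordX (character ρ) ^ 3 +
      coordX (character ρ) * coordU (character ρ) ^ 2 - coordX (character ρ) * coordU (character ρ) -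
      4 * coordX (character ρ) := by
  have := (isTracePair ρ).trace_meridian_longitude h
  rw [← coe_map_α_inv, ← coe_map_β_inv, one_mul] at this
  simp only [← Matrix.SpecialLinearGroup.coe_mul, ← map_mul] at this
  rw [← this, character, longitude]
  simp only [mul_assoc]

end FigEight

/-! ### Valuations of the function field of the curve -/

namespace FigEight

open Polynomial

theorem OnCurve.isUnit {R : Type} [CommRing R] {x u : R} (h : OnCurve x u) :
    u * (x ^ 2 - 3 - u) = 1 := by
  rw [OnCurve] at h
  linear_combination h

/-- The involution u ↦ u⁻¹, written without division; it exchanges the two ideal points. -/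
theorem OnCurve.symm {R : Type} [CommRing R] {x u : R} (h : OnCurve x u) :
    OnCurve x (x ^ 2 - 3 - u) := by
  rw [OnCurve] at h ⊢
  linear_combination h

theorem OnCurve.inv_eq {K : Type} [Field K] {x u : K} (h : OnCurve x u) :
    u⁻¹ = x ^ 2 - 3 - u :=
  inv_eq_of_mul_eq_one_right h.isUnit

theorem OnCurve.ne_zero {R : Type} [CommRing R] [Nontrivial R] {x u : R} (h : OnCurve x u) :
    u ≠ 0 := by
  rintro rfl
  simpa using h.isUnit

/-- Normal form of the regular functions on the curve. -/
theorem exists_normal_form (P : MvPolynomial (Fin 2) ℂ) :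
    ∃ (N : ℕ) (p q : ℂ[X]), ∀ (R : Type) [CommRing R] [Algebra ℂ R] (x u : R), OnCurve x u →
      u ^ N * MvPolynomial.aeval ![x, u] P = aeval u p + x * aeval u q := by
  induction P using MvPolynomial.induction_on with
  | C a => exact ⟨0, C a, 0, fun R _ _ x u _ => by simp⟩
  | add P Q hP hQ =>
    obtain ⟨N, p, q, h⟩ := hP
    obtain ⟨N', p', q', h'⟩ := hQ
    refine ⟨N + N', X ^ N' * p + X ^ N * p', X ^ N' * q + X ^ N * q', fun R _ _ x u hF => ?_⟩
    simp only [map_add, map_mul, map_pow, aeval_X]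
    linear_combination u ^ N' * h R x u hF + u ^ N * h' R x u hF
  | mul_X P i hP =>
    obtain ⟨N, p, q, h⟩ := hP
    fin_cases i
    -- One more factor u is spent on replacing ux² by u² + 3u + 1.
    · refine ⟨N + 1, (X ^ 2 + 3 * X + 1) * q, X * p, fun R _ _ x u hF => ?_⟩
      have hF' := hF
      rw [OnCurve] at hF'
      simp [map_ofNat]
      linear_combination u * x * h R x u hF + aeval u q * hF'
    · refine ⟨N, X * p, X * q, fun R _ _ x u hF => ?_⟩
      simp
      linear_combination u * h R x u hF

section Valuation

variable {K : Type} [Field K] [Algebra ℂ K]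

/-- The valuation is trivial on the constants. -/
def TrivialOnConst (v : Valuation K ℤᵐ⁰) : Prop :=
  ∀ c : ℂ, c ≠ 0 → v (algebraMap ℂ K c) = 1

theorem TrivialOnConst.map_le_one {v : Valuation K ℤᵐ⁰} (hv : TrivialOnConst v) (c : ℂ) :
    v (algebraMap ℂ K c) ≤ 1 := by
  by_cases hc : c = 0
  · simp [hc]
  · exact (hv c hc).le

theorem TrivialOnConst.map_mvAeval_le_one {v : Valuation K ℤᵐ⁰} (hv : TrivialOnConst v) {x u : K}
    (hx : v x ≤ 1) (hu : v u ≤ 1) (P : MvPolynomial (Fin 2) ℂ) :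
    v (MvPolynomial.aeval ![x, u] P) ≤ 1 := by
  induction P using MvPolynomial.induction_on with
  | C a => simpa using hv.map_le_one a
  | add P Q hP hQ => rw [map_add]; exact v.map_add_le hP hQ
  | mul_X P i hP =>
    rw [map_mul, map_mul]
    refine mul_le_one' hP ?_
    fin_cases i <;> simpa

theorem TrivialOnConst.map_aeval_le_one {v : Valuation K ℤᵐ⁰} (hv : TrivialOnConst v) {u : K}
    (hu : v u ≤ 1) (p : ℂ[X]) : v (aeval u p) ≤ 1 := by
  induction p using Polynomial.induction_on' with
  | add p q hp hq => rw [map_add]; exact v.map_add_le hp hq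
  | monomial n a =>
    rw [aeval_monomial, map_mul, map_pow]
    exact mul_le_one' (hv.map_le_one a) (pow_le_one' hu n)

/-- Only the lowest-order term of p counts when u has a zero: the cofactor of the power of X has a
nonzero constant term, so its value at u is a unit. -/
theorem TrivialOnConst.map_aeval {v : Valuation K ℤᵐ⁰} (hv : TrivialOnConst v) {u : K}
    (hu : v u < 1) {p : ℂ[X]} (hp : p ≠ 0) :
    v (aeval u p) = v u ^ p.rootMultiplicity 0 := by
  obtain ⟨q, hq, hdvd⟩ := p.exists_eq_pow_rootMultiplicity_mul_and_not_dvd hp 0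
  have hq0 : q.coeff 0 ≠ 0 := by rwa [C_0, sub_zero, X_dvd_iff] at hdvd
  have h1 : v (aeval u q) = 1 := by
    rw [← q.divX_mul_X_add, map_add, aeval_C, map_mul, aeval_X, add_comm]
    rw [v.map_add_eq_of_lt_left, hv _ hq0]
    rw [hv _ hq0, map_mul]
    exact (mul_le_of_le_one_left zero_le (hv.map_aeval_le_one hu.le _)).trans_lt hu
  conv_lhs => rw [hq]
  rw [C_0, sub_zero, map_mul, map_mul, map_pow, aeval_X, map_pow, h1, mul_one]

theorem TrivialOnConst.transcendental {v : Valuation K ℤᵐ⁰} (hv : TrivialOnConst v) {u : K}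
    (hu0 : u ≠ 0) (hu : v u ≠ 1) : Transcendental ℂ u := by
  have key : ∀ w : K, w ≠ 0 → v w < 1 → Transcendental ℂ w := by
    intro w hw0 hw
    rw [transcendental_iff]
    intro p hp
    by_contra hp0
    have := hv.map_aeval hw hp0
    rw [hp, map_zero] at this
    exact pow_ne_zero _ ((v.ne_zero_iff).mpr hw0) this.symm
  rcases lt_or_gt_of_ne hu with h | h
  · exact key u hu0 h
  · have := key u⁻¹ (inv_ne_zero hu0) (by rw [map_inv₀]; exact inv_lt_one_of_one_lt₀ h)
    exact fun h' => this (IsAlgebraic.inv_iff.mpr h')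

variable {x u : K}

/-- The right side u² + 3u + 1 of the equation is a unit when v(u) < 1, so ux² is one too. -/
theorem TrivialOnConst.map_curve {v : Valuation K ℤᵐ⁰} (hv : TrivialOnConst v) (h : OnCurve x u)
    (hu : v u < 1) : v u = v x ^ (-2 : ℤ) := by
  have h1 : v (u ^ 2 + 3 * u + 1) = 1 := by
    have := hv.map_aeval hu (p := X ^ 2 + 3 * X + 1) (by
      intro h0
      have := congrArg (Polynomial.eval 0) h0
      simp at this)
    rw [Polynomial.rootMultiplicity_eq_zero (by simp), pow_zero] at this
    simpa [map_ofNat] using this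
  rw [← h, map_mul, map_pow] at h1
  rw [_root_.zpow_neg, eq_inv_of_mul_eq_one_left h1]
  norm_cast

theorem TrivialOnConst.one_lt_map_curve {v : Valuation K ℤᵐ⁰} (hv : TrivialOnConst v)
    (h : OnCurve x u) (hu : v u < 1) : 1 < v x := by
  by_contra! hx
  have h1 := hv.map_curve h hu
  have h2 : (1 : ℤᵐ⁰) = v u * v x ^ 2 := by
    have hx0 : v x ≠ 0 := by
      intro hx0
      rw [hx0, _root_.zero_zpow _ (by norm_num)] at h1
      exact h.ne_zero ((v.zero_iff).mp h1)
    rw [h1, ← zpow_natCast, ← zpow_add₀ hx0]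
    norm_num
  have h3 : v u * v x ^ 2 < 1 := mul_lt_one_of_lt_of_le hu (pow_le_one' hx 2)
  exact h3.ne' h2

/-- In powers of v(x), p(u) has an even exponent and x q(u) an odd one, so the terms cannot cancel
and the larger exponent wins. The exponent is chosen before v, which is what makes the place unique.
-/
theorem exists_zpow_comb (h : OnCurve x u) {p q : ℂ[X]} (hpq : ¬ (p = 0 ∧ q = 0)) :
    ∃ k : ℤ, ∀ v : Valuation K ℤᵐ⁰, TrivialOnConst v → v u < 1 →
      v (aeval u p + x * aeval u q) = v x ^ k := by
  have hp : p ≠ 0 → ∀ v : Valuation K ℤᵐ⁰, TrivialOnConst v → v u < 1 →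
      v (aeval u p) = v x ^ (-2 * (p.rootMultiplicity 0 : ℤ)) := by
    intro hp v hv hu
    rw [hv.map_aeval hu hp, hv.map_curve h hu, _root_.zpow_mul, zpow_natCast]
  have hq : q ≠ 0 → ∀ v : Valuation K ℤᵐ⁰, TrivialOnConst v → v u < 1 →
      v (x * aeval u q) = v x ^ (1 - 2 * (q.rootMultiplicity 0 : ℤ)) := by
    intro hq v hv hu
    have hx := hv.one_lt_map_curve h hu
    rw [map_mul, hv.map_aeval hu hq, hv.map_curve h hu, ← zpow_natCast, ← _root_.zpow_mul,
      sub_eq_add_neg, zpow_add₀ (zero_lt_one.trans hx).ne', zpow_one, neg_mul]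
  by_cases hp0 : p = 0
  · have hq0 : q ≠ 0 := fun hq0 => hpq ⟨hp0, hq0⟩
    refine ⟨1 - 2 * (q.rootMultiplicity 0 : ℤ), fun v hv hu => ?_⟩
    rw [hp0, map_zero, zero_add, hq hq0 v hv hu]
  by_cases hq0 : q = 0
  · refine ⟨-2 * (p.rootMultiplicity 0 : ℤ), fun v hv hu => ?_⟩
    rw [hq0, map_zero, mul_zero, add_zero, hp hp0 v hv hu]
  refine ⟨max (-2 * (p.rootMultiplicity 0 : ℤ)) (1 - 2 * (q.rootMultiplicity 0 : ℤ)),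
    fun v hv hu => ?_⟩
  have hmono := zpow_right_strictMono₀ (hv.one_lt_map_curve h hu)
  rw [v.map_add_of_distinct_val, hp hp0 v hv hu, hq hq0 v hv hu, hmono.monotone.map_max]
  rw [hp hp0 v hv hu, hq hq0 v hv hu, hmono.injective.ne_iff]
  omega

theorem exists_zpow_mvAeval (h : OnCurve x u) {P : MvPolynomial (Fin 2) ℂ}
    (hP : MvPolynomial.aeval ![x, u] P ≠ 0) :
    ∃ k : ℤ, ∀ v : Valuation K ℤᵐ⁰, TrivialOnConst v → v u < 1 →
      v (MvPolynomial.aeval ![x, u] P) = v x ^ k := by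
  obtain ⟨N, p, q, hN⟩ := exists_normal_form P
  have hN := hN K x u h
  have hpq : ¬ (p = 0 ∧ q = 0) := by
    rintro ⟨rfl, rfl⟩
    rw [map_zero, mul_zero, add_zero] at hN
    exact mul_ne_zero (pow_ne_zero _ h.ne_zero) hP hN
  obtain ⟨k, hk⟩ := exists_zpow_comb h hpq
  refine ⟨k + 2 * N, fun v hv hu => ?_⟩
  have hx0 := (zero_lt_one.trans (hv.one_lt_map_curve h hu)).ne'
  have h1 := hk v hv hu
  rw [← hN, map_mul, map_pow, hv.map_curve h hu, ← zpow_natCast, ← _root_.zpow_mul] at h1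
  rw [zpow_add₀ hx0, ← h1, mul_comm, ← mul_assoc, ← zpow_add₀ hx0]
  ring_nf
  simp

/-- Every element of `K` is a quotient of polynomials in `x` and `u`. -/
def GeneratedBy (x u : K) : Prop :=
  ∀ f : K, ∃ P Q : MvPolynomial (Fin 2) ℂ, MvPolynomial.aeval ![x, u] Q ≠ 0 ∧
    f * MvPolynomial.aeval ![x, u] Q = MvPolynomial.aeval ![x, u] P

theorem GeneratedBy.inv (h : OnCurve x u) (hg : GeneratedBy x u) : GeneratedBy x u⁻¹ := by
  have key : ∀ P : MvPolynomial (Fin 2) ℂ, ∃ P' : MvPolynomial (Fin 2) ℂ,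
      MvPolynomial.aeval ![x, u⁻¹] P' = MvPolynomial.aeval ![x, u] P := by
    intro P
    refine ⟨MvPolynomial.aeval ![MvPolynomial.X 0,
      MvPolynomial.X 0 ^ 2 - 3 - MvPolynomial.X 1] P, ?_⟩
    rw [← AlgHom.comp_apply]
    congr 1
    ext i
    fin_cases i
    · simp
    · simp [h.inv_eq, map_ofNat]
  intro f
  obtain ⟨P, Q, hQ, hf⟩ := hg f
  obtain ⟨P', hP'⟩ := key P
  obtain ⟨Q', hQ'⟩ := key Q
  exact ⟨P', Q', by rwa [hQ'], by rw [hQ', hP', hf]⟩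

theorem GeneratedBy.exists_zpow (h : OnCurve x u) (hg : GeneratedBy x u) {f : K} (hf : f ≠ 0) :
    ∃ k : ℤ, ∀ v : Valuation K ℤᵐ⁰, TrivialOnConst v → v u < 1 → v f = v x ^ k := by
  obtain ⟨P, Q, hQ, hfQ⟩ := hg f
  have hP : MvPolynomial.aeval ![x, u] P ≠ 0 := by
    rw [← hfQ]
    exact mul_ne_zero hf hQ
  obtain ⟨k, hk⟩ := exists_zpow_mvAeval h hP
  obtain ⟨l, hl⟩ := exists_zpow_mvAeval h hQ
  refine ⟨k - l, fun v hv hu => ?_⟩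
  have hx0 := (zero_lt_one.trans (hv.one_lt_map_curve h hu)).ne'
  rw [eq_div_of_mul_eq hQ hfQ, map_div₀, hk v hv hu, hl v hv hu, zpow_sub₀ hx0]

/-- All nonzero values are powers of v(x) > 1, and a normalized valuation attains `exp 1`. -/
theorem GeneratedBy.map_eq_exp_one (h : OnCurve x u) (hg : GeneratedBy x u) (P : Place K)
    (hu : P.v u < 1) : P.v x = exp 1 := by
  have hv : TrivialOnConst P.v := P.trivial_const
  obtain ⟨f, hf⟩ := P.surj (exp 1)
  have hf0 : f ≠ 0 := by
    rintro rfl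
    rw [map_zero] at hf
    exact exp_ne_zero hf.symm
  obtain ⟨k, hk⟩ := hg.exists_zpow h hf0
  have h1 := hk P.v hv hu
  have hx := hv.one_lt_map_curve h hu
  have hx0 := (zero_lt_one.trans hx).ne'
  rw [hf] at h1
  have h2 := congrArg log h1
  rw [log_exp, log_zpow, smul_eq_mul] at h2
  have h3 : 0 < log (P.v x) := by
    rw [← log_one, log_lt_log one_ne_zero hx0]
    exact hx
  have h4 : log (P.v x) = 1 := by
    have := Int.eq_one_or_neg_one_of_mul_eq_one' h2.symm
    omega
  rw [← exp_log hx0, h4]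

/-- There is only one place at which `u` has a zero. -/
theorem GeneratedBy.place_unique (h : OnCurve x u) (hg : GeneratedBy x u) {P Q : Place K}
    (hP : P.v u < 1) (hQ : Q.v u < 1) : P = Q := by
  have hv : P.v = Q.v := by
    ext f
    by_cases hf : f = 0
    · simp [hf]
    · obtain ⟨k, hk⟩ := hg.exists_zpow h hf
      rw [hk P.v P.trivial_const hP, hk Q.v Q.trivial_const hQ, hg.map_eq_exp_one h P hP,
        hg.map_eq_exp_one h Q hQ]
  cases P
  cases Q
  cases hv
  rfl

theorem TrivialOnConst.map_le_one_of_curve {v : Valuation K ℤᵐ⁰} (hv : TrivialOnConst v)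
    (h : OnCurve x u) (hu : v u = 1) : v x ≤ 1 := by
  have h1 : x ^ 2 = u⁻¹ + (algebraMap ℂ K 3 + u) := by
    rw [h.inv_eq, map_ofNat]
    ring
  have h2 : v (x ^ 2) ≤ 1 := by
    rw [h1]
    refine v.map_add_le ?_ (v.map_add_le (hv.map_le_one 3) hu.le)
    rw [map_inv₀, hu, inv_one]
  rw [map_pow] at h2
  exact le_of_not_gt fun h3 => (one_lt_pow₀ h3 two_ne_zero).not_ge h2

end Valuation

/-! ### Polynomials vanishing on the curve -/

/-- A polynomial that vanishes at a generic point of the curve vanishes on the curve. -/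
theorem mvAeval_eq_zero_of_generic {K : Type} [Field K] [Algebra ℂ K] {x u : K} (h : OnCurve x u)
    (hu : Transcendental ℂ u) {P : MvPolynomial (Fin 2) ℂ}
    (hP : MvPolynomial.aeval ![x, u] P = 0) {R : Type} [CommRing R] [Algebra ℂ R] {x' u' : R}
    (h' : OnCurve x' u') : MvPolynomial.aeval ![x', u'] P = 0 := by
  obtain ⟨N, p, q, hN⟩ := exists_normal_form P
  have h1 := hN K x u h
  rw [hP, mul_zero] at h1
  -- This is u times the norm (p + xq)(p - xq). The two products have degrees of opposite parity, so
  -- their equality forces p = q = 0.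
  have h2 : aeval u (X * p ^ 2 - (X ^ 2 + 3 * X + 1) * q ^ 2) = 0 := by
    have hF := h
    rw [OnCurve] at hF
    simp [map_ofNat]
    linear_combination -(u * aeval u p - u * x * aeval u q) * h1 + hF * aeval u q ^ 2
  have h3 := (transcendental_iff.mp hu) _ h2
  have hc : (X ^ 2 + 3 * X + 1 : ℂ[X]).natDegree = 2 := by compute_degree!
  have hc0 : (X ^ 2 + 3 * X + 1 : ℂ[X]) ≠ 0 := by
    intro h0
    rw [h0] at hc
    simp at hc
  have hq : q = 0 := by
    by_contra hq
    have hp : p ≠ 0 := by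
      rintro rfl
      apply mul_ne_zero hc0 (pow_ne_zero 2 hq)
      linear_combination -h3
    have h4 := congrArg natDegree (sub_eq_zero.mp h3)
    rw [natDegree_mul X_ne_zero (pow_ne_zero 2 hp), natDegree_mul hc0 (pow_ne_zero 2 hq), hc,
      natDegree_X, natDegree_pow, natDegree_pow] at h4
    omega
  have hp : p = 0 := by
    rw [hq] at h3
    simpa using h3
  have h5 := hN R x' u' h'
  rw [hp, hq, map_zero, mul_zero, add_zero] at h5
  have h6 : IsUnit u' := IsUnit.of_mul_eq_one _ h'.isUnit
  exact (h6.pow N).mul_right_eq_zero.mp h5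

/-- A polynomial that vanishes at all complex points of the curve vanishes on the curve. -/
theorem mvAeval_eq_zero_of_forall {P : MvPolynomial (Fin 2) ℂ}
    (hP : ∀ x u : ℂ, OnCurve x u → MvPolynomial.aeval ![x, u] P = 0) {R : Type} [CommRing R]
    [Algebra ℂ R] {x' u' : R} (h' : OnCurve x' u') : MvPolynomial.aeval ![x', u'] P = 0 := by
  obtain ⟨N, p, q, hN⟩ := exists_normal_form P
  have key : ∀ u : ℂ, u ≠ 0 → p.eval u = 0 ∧ ((X ^ 2 + 3 * X + 1) * q).eval u = 0 := by
    intro u hu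
    obtain ⟨x, hx⟩ := IsAlgClosed.exists_pow_nat_eq ((u ^ 2 + 3 * u + 1) / u) (n := 2) two_pos
    have h1 : OnCurve x u := by
      rw [OnCurve, hx]
      field_simp
    -- The points (x, u) and (-x, u) separate p(u) from x q(u).
    have h2 : OnCurve (-x) u := by
      rw [OnCurve, neg_sq]
      exact h1
    have e1 := hN ℂ x u h1
    have e2 := hN ℂ (-x) u h2
    rw [hP x u h1, mul_zero] at e1
    rw [hP (-x) u h2, mul_zero] at e2
    simp only [coe_aeval_eq_eval] at e1 e2
    rw [OnCurve] at h1
    refine ⟨by linear_combination -(e1 + e2) / 2, ?_⟩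
    simp [-mul_eq_zero]
    linear_combination -(e1 - e2) / 2 * u * x - h1 * q.eval u
  have hinf : ({0}ᶜ : Set ℂ).Infinite := (Set.finite_singleton 0).infinite_compl
  have hp : p = 0 := eq_zero_of_infinite_isRoot p (hinf.mono fun u hu => (key u hu).1)
  have hq : q = 0 := by
    have h1 := eq_zero_of_infinite_isRoot _ (hinf.mono fun u hu => (key u hu).2)
    refine (mul_eq_zero.mp h1).resolve_left fun h0 => ?_
    have := congrArg (eval 0) h0
    simp at this
  have h5 := hN R x' u' h'
  rw [hp, hq, map_zero, mul_zero, add_zero] at h5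
  have h6 : IsUnit u' := IsUnit.of_mul_eq_one _ h'.isUnit
  exact (h6.pow N).mul_right_eq_zero.mp h5

end FigEight

/-! ### Laurent expansions at the ideal points -/

namespace FigEight

/-- The point `(x, u)` of the curve has the eigenvalue `M` of the meridian and the corresponding
eigenvalue `L` of the longitude. -/
structure IsEigenvaluePoint {K : Type} [Field K] (x u M L : K) : Prop where
  onCurve : OnCurve x u
  meridian_ne_zero : M ≠ 0
  longitude_ne_zero : L ≠ 0
  trace_meridian : x = M + M⁻¹
  trace_longitude : x ^ 4 - 5 * x ^ 2 + 2 = L + L⁻¹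
  trace_mul : x ^ 3 + x * u ^ 2 - x * u - 4 * x = M * L + M⁻¹ * L⁻¹

/-- The involution of the curve fixes the trace of the longitude and exchanges the traces of αλ and
αλ⁻¹, whose sum is tr(α) tr(λ). -/
theorem IsEigenvaluePoint.inv {K : Type} [Field K] {x u M L : K} (h : IsEigenvaluePoint x u M L) :
    IsEigenvaluePoint x u⁻¹ M L⁻¹ where
  onCurve := by
    rw [h.onCurve.inv_eq]
    exact h.onCurve.symm
  meridian_ne_zero := h.meridian_ne_zero
  longitude_ne_zero := inv_ne_zero h.longitude_ne_zero
  trace_meridian := h.trace_meridian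
  trace_longitude := by rw [inv_inv, h.trace_longitude, add_comm]
  trace_mul := by
    have hF := h.onCurve
    rw [OnCurve] at hF
    rw [h.onCurve.inv_eq, inv_inv]
    linear_combination x * h.trace_longitude + (L + L⁻¹) * h.trace_meridian - h.trace_mul
      - 2 * x * hF

/-- With x = t⁻¹ + t, the quadratic formula for u² - (x² - 3)u + 1 = 0 gives u. The quadratic
equation of L has the root of its discriminant equal to (1 - t⁴)s up to a power of t; the trace of
αλ selects the sign of s. -/
theorem isEigenvaluePoint_of_sq_eq {K : Type} [Field K] [CharZero K] {t s : K} (ht : t ≠ 0)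
    (hs : s ^ 2 = (1 - t ^ 2 + t ^ 4) ^ 2 - 4 * t ^ 4) :
    IsEigenvaluePoint (t⁻¹ + t) ((1 - t ^ 2 + t ^ 4 + s) / (2 * t ^ 2)) t⁻¹
        ((1 - t ^ 2 - 2 * t ^ 4 - t ^ 6 + t ^ 8 + (1 - t ^ 4) * s) / (2 * t ^ 4)) := by
  have hL : (1 - t ^ 2 - 2 * t ^ 4 - t ^ 6 + t ^ 8 + (1 - t ^ 4) * s) / (2 * t ^ 4) *
        ((1 - t ^ 2 - 2 * t ^ 4 - t ^ 6 + t ^ 8 - (1 - t ^ 4) * s) / (2 * t ^ 4)) = 1 := by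
    field_simp
    linear_combination -(1 - t ^ 4) ^ 2 * hs
  have hL' := inv_eq_of_mul_eq_one_right hL
  refine ⟨?_, inv_ne_zero ht, left_ne_zero_of_mul_eq_one hL, by rw [inv_inv], ?_, ?_⟩
  · rw [OnCurve]
    field_simp
    linear_combination -hs
  · rw [hL']
    field_simp
    ring
  · rw [hL']
    field_simp
    linear_combination (t ^ 2 + 1) * hs

/-- A power series with constant coefficient `1` has a square root. -/
theorem exists_sq_eq_of_constantCoeff {d : PowerSeries ℂ} (hd : PowerSeries.constantCoeff d = 1) :
    ∃ s : PowerSeries ℂ, s ^ 2 = d ∧ PowerSeries.constantCoeff s = 1 := by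
  have hs : PowerSeries.HasSubst (d - 1) :=
    PowerSeries.HasSubst.of_constantCoeff_zero
      (show PowerSeries.constantCoeff (d - 1) = 0 by simp [hd])
  -- The square root is the binomial series of (1 + X)^(1/2) with d - 1 substituted for X.
  have h1 : (PowerSeries.binomialSeries ℂ (1 / 2 : ℂ)) ^ 2 = 1 + PowerSeries.X := by
    have := PowerSeries.binomialSeries_nat (R := ℂ) (A := ℂ) 1
    rw [sq, ← PowerSeries.binomialSeries_add]
    norm_num at this ⊢
    exact this
  have h2 := congrArg (PowerSeries.substAlgHom hs) h1
  rw [map_pow, map_add, map_one, PowerSeries.substAlgHom_X, add_sub_cancel] at h2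
  have h3 := congrArg PowerSeries.constantCoeff h2
  rw [hd, map_pow] at h3
  rcases eq_or_eq_neg_of_sq_eq_sq _ 1 (h3.trans (one_pow 2).symm) with h4 | h4
  · exact ⟨_, h2, h4⟩
  · exact ⟨-_, (neg_sq _).trans h2, by rw [map_neg, h4, neg_neg]⟩

theorem valued_ofPowerSeries {F : PowerSeries ℂ} (hF : PowerSeries.constantCoeff F ≠ 0) :
    (Valued.v (HahnSeries.ofPowerSeries ℤ ℂ F) : ℤᵐ⁰) = 1 := by
  have h1 : ∀ F : PowerSeries ℂ, (Valued.v (HahnSeries.ofPowerSeries ℤ ℂ F) : ℤᵐ⁰) ≤ 1 :=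
    fun F => (LaurentSeries.val_le_one_iff_eq_coe ℂ _).mpr ⟨F, rfl⟩
  obtain ⟨G, hG⟩ :=
    (PowerSeries.isUnit_iff_constantCoeff.mpr (isUnit_iff_ne_zero.mpr hF)).exists_right_inv
  have h2 := congrArg
    (fun f => (Valued.v (HahnSeries.ofPowerSeries ℤ ℂ f) : ℤᵐ⁰)) hG
  simp only [map_mul, map_one] at h2
  refine le_antisymm (h1 F) ?_
  rw [← h2]
  exact mul_le_of_le_one_right zero_le (h1 G)

theorem trivialOnConst_laurentSeries :
    TrivialOnConst (Valued.v : Valuation (LaurentSeries ℂ) ℤᵐ⁰) := by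
  intro c hc
  have h : algebraMap ℂ (LaurentSeries ℂ) c = HahnSeries.ofPowerSeries ℤ ℂ (PowerSeries.C c) := by
    rw [HahnSeries.ofPowerSeries_C, LaurentSeries.algebraMap_apply]
  rw [h]
  exact valued_ofPowerSeries (by simpa)

theorem exists_laurent_points : ∃ x M u₁ u₂ L₁ L₂ : LaurentSeries ℂ,
    IsEigenvaluePoint x u₁ M L₁ ∧ IsEigenvaluePoint x u₂ M L₂ ∧
    (Valued.v M : ℤᵐ⁰) = exp 1 ∧ (Valued.v u₁ : ℤᵐ⁰) = exp (-2) ∧ (Valued.v u₂ : ℤᵐ⁰) = exp 2 ∧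
    (Valued.v L₁ : ℤᵐ⁰) = exp (-4) ∧ (Valued.v L₂ : ℤᵐ⁰) = exp 4 := by
  let X : PowerSeries ℂ := PowerSeries.X
  -- With s(0) = 1 the numerators of u and L have constant term 2, so the pole orders 2 and 4 are
  -- read off the denominators. Inverting u and L gives the other expansion.
  obtain ⟨s, hs, hs0⟩ := exists_sq_eq_of_constantCoeff
    (d := (1 - X ^ 2 + X ^ 4) ^ 2 - 4 * X ^ 4) (by simp [X])
  let φ : PowerSeries ℂ →+* LaurentSeries ℂ := HahnSeries.ofPowerSeries ℤ ℂ
  let t : LaurentSeries ℂ := φ X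
  have hvt : (Valued.v t : ℤᵐ⁰) = exp (-1) := by
    have := LaurentSeries.valuation_single_zpow ℂ 1
    rwa [← HahnSeries.ofPowerSeries_X] at this
  have ht : t ≠ 0 := by
    rw [← Valuation.ne_zero_iff Valued.v, hvt]
    exact exp_ne_zero
  have hst : (φ s) ^ 2 = (1 - t ^ 2 + t ^ 4) ^ 2 - 4 * t ^ 4 := by
    rw [← map_pow, hs]
    simp [t, map_ofNat]
  have : CharZero (LaurentSeries ℂ) :=
    charZero_of_injective_algebraMap (algebraMap ℂ (LaurentSeries ℂ)).injective
  have h1 := isEigenvaluePoint_of_sq_eq ht hst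
  have hv2 : (Valued.v (2 : LaurentSeries ℂ) : ℤᵐ⁰) = 1 := by
    have := trivialOnConst_laurentSeries 2 two_ne_zero
    rwa [map_ofNat] at this
  have hvu : (Valued.v ((1 - t ^ 2 + t ^ 4 + φ s) / (2 * t ^ 2)) : ℤᵐ⁰) = exp 2 := by
    have h3 : (1 - t ^ 2 + t ^ 4 + φ s) = φ (1 - X ^ 2 + X ^ 4 + s) := by simp [t]
    rw [map_div₀, h3, valued_ofPowerSeries, map_mul, map_pow, hvt, hv2, one_mul]
    · rfl
    · simp [X, hs0]
  have hvL : (Valued.v ((1 - t ^ 2 - 2 * t ^ 4 - t ^ 6 + t ^ 8 + (1 - t ^ 4) * φ s) /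
      (2 * t ^ 4)) : ℤᵐ⁰) = exp 4 := by
    have h3 : 1 - t ^ 2 - 2 * t ^ 4 - t ^ 6 + t ^ 8 + (1 - t ^ 4) * φ s =
        φ (1 - X ^ 2 - 2 * X ^ 4 - X ^ 6 + X ^ 8 + (1 - X ^ 4) * s) := by simp [t, map_ofNat]
    rw [map_div₀, h3, valued_ofPowerSeries, map_mul, map_pow, hvt, hv2, one_mul]
    · rfl
    · simp [X, hs0]
  refine ⟨_, _, _, _, _, _, h1.inv, h1, ?_, ?_, hvu, ?_, hvL⟩
  · rw [map_inv₀, hvt]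
    rfl
  · rw [map_inv₀, hvu]
    rfl
  · rw [map_inv₀, hvL]
    rfl

end FigEight

/-! ### The curve of irreducible characters -/

namespace CharVar

variable {G : Type}

/-- The value of a regular function at a point. -/
def evalPoint (S : Set (G → ℂ)) (χ : S) : coordRing S →ₐ[ℂ] ℂ :=
  (Pi.evalAlgHom ℂ (fun _ : S => ℂ) χ).comp (coordRing S).val

theorem evalPoint_regFun (S : Set (G → ℂ)) (χ : S) (g : G) :
    evalPoint S χ (regFun S g) = χ.1 g := rfl

theorem coordRing_ext {S : Set (G → ℂ)} {f g : coordRing S}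
    (h : ∀ χ : S, evalPoint S χ f = evalPoint S χ g) : f = g :=
  Subtype.ext (funext h)

theorem regFun_mul_add_regFun_inv_mul [Group G] {S : Set (G → ℂ)} (hS : S ⊆ characterVariety G) (g h : G) :
    regFun S (g * h) + regFun S (g⁻¹ * h) = regFun S g * regFun S h := by
  refine coordRing_ext fun χ => ?_
  obtain ⟨ρ, hρ⟩ := hS χ.2
  simp only [map_add, map_mul, evalPoint_regFun, ← hρ]
  exact character_mul_add_mul_inv ρ g h

end CharVar

namespace FigEight

/-- The coordinate `u` as a regular function. -/
def regU (S : Set (KnotGroup → ℂ)) : coordRing S :=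
  regFun S (α * β⁻¹) - 1

theorem evalPoint_aeval (S : Set (KnotGroup → ℂ)) (χ : S) (P : MvPolynomial (Fin 2) ℂ) :
    evalPoint S χ (MvPolynomial.aeval ![regFun S α, regU S] P) =
      MvPolynomial.aeval ![coordX χ.1, coordU χ.1] P := by
  rw [← AlgHom.comp_apply]
  congr 1
  ext i
  fin_cases i
  · simp [evalPoint_regFun, coordX]
  · simp [regU, evalPoint_regFun, coordU]

theorem exists_regFun_eq_aeval {S : Set (KnotGroup → ℂ)} (hS : S ⊆ characterVariety KnotGroup)
    (g : KnotGroup) :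
    ∃ P : MvPolynomial (Fin 2) ℂ, MvPolynomial.aeval ![regFun S α, regU S] P = regFun S g := by
  obtain ⟨P, hP⟩ := exists_trace_polynomial g
  refine ⟨P, coordRing_ext fun χ => ?_⟩
  obtain ⟨ρ, hρ⟩ := hS χ.2
  rw [evalPoint_aeval, evalPoint_regFun, ← hρ, hP ρ]
  rfl

theorem aeval_coordRing_surjective {S : Set (KnotGroup → ℂ)}
    (hS : S ⊆ characterVariety KnotGroup) :
    Function.Surjective (MvPolynomial.aeval (R := ℂ) ![regFun S α, regU S]) := by
  have h1 : coordRing S ≤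
      ((coordRing S).val.comp (MvPolynomial.aeval ![regFun S α, regU S])).range := by
    refine Algebra.adjoin_le ?_
    rintro _ ⟨g, rfl⟩
    obtain ⟨P, hP⟩ := exists_regFun_eq_aeval hS g
    exact ⟨P, congrArg Subtype.val hP⟩
  intro f
  obtain ⟨P, hP⟩ := h1 f.2
  exact ⟨P, Subtype.ext hP⟩

/-- The curve of the characters with `u x² = u² + 3u + 1`. -/
def irrCurve : Set (KnotGroup → ℂ) :=
  {χ | χ ∈ characterVariety KnotGroup ∧ OnCurve (coordX χ) (coordU χ)}

theorem irrCurve_subset : irrCurve ⊆ characterVariety KnotGroup := fun _ h => h.1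

theorem exists_mem_irrCurve {x u : ℂ} (h : OnCurve x u) :
    ∃ χ ∈ irrCurve, coordX χ = x ∧ coordU χ = u := by
  obtain ⟨ρ, hx, hu⟩ := exists_rep_of_onCurve h
  exact ⟨character ρ, ⟨⟨ρ, rfl⟩, by rwa [hx, hu]⟩, hx, hu⟩

theorem onCurve_regFun : OnCurve (regFun irrCurve α) (regU irrCurve) := by
  refine coordRing_ext fun χ => ?_
  have h : OnCurve (coordX χ.1) (coordU χ.1) := χ.2.2
  simpa [regU, evalPoint_regFun, map_ofNat, OnCurve, coordX, coordU] using h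

theorem aeval_regFun_eq_zero_iff {P : MvPolynomial (Fin 2) ℂ} :
    MvPolynomial.aeval ![regFun irrCurve α, regU irrCurve] P = 0 ↔
      ∀ x u : ℂ, OnCurve x u → MvPolynomial.aeval ![x, u] P = 0 := by
  refine ⟨fun h x u hF => ?_, fun h => mvAeval_eq_zero_of_forall h onCurve_regFun⟩
  obtain ⟨χ, hχ, rfl, rfl⟩ := exists_mem_irrCurve hF
  rw [← evalPoint_aeval irrCurve ⟨χ, hχ⟩, h, map_zero]

/-- Points of the curve with coordinates in a `ℂ`-algebra are homomorphisms from the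
coordinate ring. -/
theorem exists_algHom_of_onCurve {R : Type} [CommRing R] [Algebra ℂ R] {x u : R}
    (h : OnCurve x u) :
    ∃ φ : coordRing irrCurve →ₐ[ℂ] R, φ (regFun irrCurve α) = x ∧ φ (regU irrCurve) = u := by
  have hs := aeval_coordRing_surjective irrCurve_subset
  have hker : RingHom.ker
      (MvPolynomial.aeval (R := ℂ) ![regFun irrCurve α, regU irrCurve]).toRingHom ≤
      RingHom.ker (MvPolynomial.aeval (R := ℂ) ![x, u]).toRingHom := fun P hP =>
    mvAeval_eq_zero_of_forall (aeval_regFun_eq_zero_iff.mp hP) h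
  have key := AlgHom.liftOfSurjective_apply _ hs _ hker
  refine ⟨AlgHom.liftOfSurjective _ hs _ hker, ?_, ?_⟩
  · simpa using key (MvPolynomial.X 0)
  · simpa using key (MvPolynomial.X 1)

theorem algHom_aeval {R : Type} [CommRing R] [Algebra ℂ R] {S : Set (KnotGroup → ℂ)}
    (φ : coordRing S →ₐ[ℂ] R) (P : MvPolynomial (Fin 2) ℂ) :
    φ (MvPolynomial.aeval ![regFun S α, regU S] P) =
      MvPolynomial.aeval ![φ (regFun S α), φ (regU S)] P := by
  rw [← AlgHom.comp_apply]
  congr 1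
  ext i
  fin_cases i <;> simp

/-- A point with transcendental u is generic on the curve. -/
theorem algHom_injective {K : Type} [Field K] [Algebra ℂ K] (φ : coordRing irrCurve →ₐ[ℂ] K)
    (hu : Transcendental ℂ (φ (regU irrCurve))) : Function.Injective φ := by
  rw [injective_iff_map_eq_zero]
  intro f hf
  obtain ⟨P, rfl⟩ := aeval_coordRing_surjective irrCurve_subset f
  rw [algHom_aeval] at hf
  refine mvAeval_eq_zero_of_generic ?_ hu hf onCurve_regFun
  have := congrArg φ onCurve_regFun
  simpa [OnCurve, map_ofNat] using this

theorem exists_eigenvalue_algHom {K : Type} [Field K] [Algebra ℂ K] {v : Valuation K ℤᵐ⁰}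
    (hv : TrivialOnConst v) {x u M L : K} (h : IsEigenvaluePoint x u M L) (hu : v u ≠ 1) :
    ∃ φ : coordRing irrCurve →ₐ[ℂ] K, Function.Injective φ ∧
      φ (regFun irrCurve α) = x ∧ φ (regU irrCurve) = u := by
  obtain ⟨φ, hx, hu'⟩ := exists_algHom_of_onCurve h.onCurve
  refine ⟨φ, algHom_injective φ ?_, hx, hu'⟩
  rw [hu']
  exact hv.transcendental h.onCurve.ne_zero hu

/-- The expansion at an ideal point embeds the coordinate ring in the field ℂ((t)). -/
instance isDomain_irrCurve : IsDomain (coordRing irrCurve) := by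
  obtain ⟨x, M, u₁, u₂, L₁, L₂, h, -, -, hu, -⟩ := exists_laurent_points
  obtain ⟨φ, hφ, -⟩ := exists_eigenvalue_algHom trivialOnConst_laurentSeries h
    (by rw [hu, ne_eq, exp_eq_one]; norm_num)
  exact hφ.isDomain φ.toRingHom

/-! ### Components -/

/-- The product of u - 1 and the curve equation vanishes on every set of characters; in a domain one
factor vanishes. -/
theorem subset_irrCurve_or {S : Set (KnotGroup → ℂ)} (hS : S ⊆ characterVariety KnotGroup)
    (hirr : IsIrreducibleSet S) : (∀ χ ∈ S, coordU χ = 1) ∨ S ⊆ irrCurve := by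
  have : IsDomain (coordRing S) := hirr
  have h1 : (regU S - 1) * (regU S * regFun S α ^ 2 - (regU S ^ 2 + 3 * regU S + 1)) = 0 := by
    refine coordRing_ext fun χ => ?_
    obtain ⟨ρ, hρ⟩ := hS χ.2
    have h2 := coordU_eq_one_or_onCurve ρ
    rw [hρ, ← sub_eq_zero, OnCurve, ← sub_eq_zero (b := _ + _), ← mul_eq_zero] at h2
    simpa [regU, evalPoint_regFun, map_ofNat, coordX, coordU] using h2
  rcases mul_eq_zero.mp h1 with h2 | h2
  · left
    intro χ hχ
    have h3 := congrArg (evalPoint S ⟨χ, hχ⟩) (sub_eq_zero.mp h2)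
    simpa [regU, evalPoint_regFun, coordU] using h3
  · right
    intro χ hχ
    have h3 := congrArg (evalPoint S ⟨χ, hχ⟩) (sub_eq_zero.mp h2)
    refine ⟨hS hχ, ?_⟩
    simpa [regU, evalPoint_regFun, map_ofNat, OnCurve, coordX, coordU] using h3

theorem exists_irreducible_mem_irrCurve :
    ∃ ρ : KnotGroup →* SL2C, IsIrreducibleRep ρ ∧ character ρ ∈ irrCurve := by
  obtain ⟨ρ, hx, hu⟩ := exists_rep_of_onCurve (x := 1) (u := -1) (by norm_num [OnCurve])
  refine ⟨ρ, ?_, ⟨ρ, rfl⟩, ?_⟩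
  · rw [isIrreducibleRep_iff, hu]
    norm_num
  · rw [hx, hu]
    norm_num [OnCurve]

theorem isComponent_irrCurve : IsComponent irrCurve := by
  refine ⟨⟨irrCurve_subset, isDomain_irrCurve⟩, fun T hT hsub => ?_⟩
  refine (subset_irrCurve_or hT.1 hT.2).resolve_left fun h => ?_
  obtain ⟨ρ, hρ, hmem⟩ := exists_irreducible_mem_irrCurve
  exact (isIrreducibleRep_iff ρ).mp hρ (h _ (hsub hmem))

theorem IsComponent.eq_irrCurve {X : Set (KnotGroup → ℂ)} (hX : IsComponent X)
    {ρ : KnotGroup →* SL2C} (hρ : IsIrreducibleRep ρ) (hmem : character ρ ∈ X) : X = irrCurve := by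
  rcases subset_irrCurve_or hX.prop.1 hX.prop.2 with h | h
  · exact absurd (h _ hmem) ((isIrreducibleRep_iff ρ).mp hρ)
  · exact hX.eq_of_subset isComponent_irrCurve.prop h

theorem mem_irrCurve_of_isIrreducibleRep {ρ : KnotGroup →* SL2C} (hρ : IsIrreducibleRep ρ) :
    character ρ ∈ irrCurve :=
  ⟨⟨ρ, rfl⟩, (coordU_eq_one_or_onCurve ρ).resolve_left ((isIrreducibleRep_iff ρ).mp hρ)⟩

/-! ### Traces of peripheral elements -/

/-- Both sides satisfy the same recurrence, which two consecutive values determine in both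
directions. -/
theorem eq_zpow_of_recurrence {K : Type} [Field K] {m a b : K} (hm : m ≠ 0) {f : ℤ → K}
    (hf : ∀ n, f (n + 1) + f (n - 1) = (m + m⁻¹) * f n) (h0 : f 0 = a + b)
    (h1 : f 1 = a * m + b * m⁻¹) (n : ℤ) : f n = a * m ^ n + b * (m ^ n)⁻¹ := by
  have key : ∀ n : ℤ, f n = a * m ^ n + b * (m ^ n)⁻¹ ∧
      f (n + 1) = a * m ^ (n + 1) + b * (m ^ (n + 1))⁻¹ := by
    intro n
    induction n with
    | zero => simp [h0, h1]
    | succ n ih =>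
      refine ⟨ih.2, ?_⟩
      have h2 := hf (n + 1)
      rw [add_sub_cancel_right, ih.1, ih.2] at h2
      rw [eq_sub_of_add_eq h2]
      simp only [zpow_add₀ hm, zpow_one]
      field_simp
      ring
    | pred n ih =>
      rw [sub_add_cancel]
      refine ⟨?_, ih.1⟩
      have h2 := hf (-n)
      rw [ih.1, ih.2, add_comm] at h2
      rw [eq_sub_of_add_eq h2]
      simp only [zpow_add₀ hm, zpow_sub₀ hm, zpow_one]
      field_simp
      ring
  exact (key n).1

theorem regFun_longitude : regFun irrCurve longitude =
    regFun irrCurve α ^ 4 - 5 * regFun irrCurve α ^ 2 + 2 := by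
  refine coordRing_ext fun χ => ?_
  obtain ⟨⟨ρ, hρ⟩, h⟩ := χ.2
  rw [← hρ] at h
  simp only [map_add, map_sub, map_mul, map_pow, map_ofNat, evalPoint_regFun, ← hρ]
  exact character_longitude h

theorem regFun_meridian_longitude : regFun irrCurve (α * longitude) =
    regFun irrCurve α ^ 3 + regFun irrCurve α * regU irrCurve ^ 2 -
      regFun irrCurve α * regU irrCurve - 4 * regFun irrCurve α := by
  refine coordRing_ext fun χ => ?_
  obtain ⟨⟨ρ, hρ⟩, h⟩ := χ.2
  rw [← hρ] at h
  simp only [regU, map_add, map_sub, map_mul, map_pow, map_ofNat, map_one, evalPoint_regFun, ← hρ]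
  exact character_meridian_longitude h

/-- The identity tr(gk) + tr(g⁻¹k) = tr(g) tr(k) gives recurrences in p and in q, so the traces of
1, α, λ, αλ determine all peripheral traces. No representation over K has to be diagonalized. -/
theorem algHom_regFun_peripheral {K : Type} [Field K] [Algebra ℂ K]
    (φ : coordRing irrCurve →ₐ[ℂ] K) {M L : K}
    (h : IsEigenvaluePoint (φ (regFun irrCurve α)) (φ (regU irrCurve)) M L) (p q : ℤ) :
    φ (regFun irrCurve (peripheral p q)) = M ^ p * L ^ q + (M ^ p * L ^ q)⁻¹ := by
  have hadd : ∀ g k : KnotGroup, φ (regFun irrCurve (g * k)) + φ (regFun irrCurve (g⁻¹ * k)) =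
      φ (regFun irrCurve g) * φ (regFun irrCurve k) := fun g k => by
    rw [← map_add, regFun_mul_add_regFun_inv_mul irrCurve_subset, map_mul]
  have hα : φ (regFun irrCurve α) = M + M⁻¹ := h.trace_meridian
  have hl : φ (regFun irrCurve longitude) = L + L⁻¹ := by
    rw [regFun_longitude, ← h.trace_longitude]
    simp [map_ofNat]
  have hαl : φ (regFun irrCurve (α * longitude)) = M * L + M⁻¹ * L⁻¹ := by
    rw [regFun_meridian_longitude, ← h.trace_mul]
    simp [map_ofNat]
  have h1 : φ (regFun irrCurve 1) = 1 + 1 := by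
    have : regFun irrCurve 1 = 1 + 1 := by
      refine coordRing_ext fun χ => ?_
      obtain ⟨ρ, hρ⟩ := χ.2.1
      rw [map_add, map_one, evalPoint_regFun, ← hρ, character_one]
      norm_num
    rw [this, map_add, map_one]
  have hcomm : ∀ (p q : ℤ), longitude * peripheral p q = peripheral p (q + 1) ∧
      longitude⁻¹ * peripheral p q = peripheral p (q - 1) := by
    intro p q
    have hc : Commute longitude (α ^ p) := commute_meridian_longitude.symm.zpow_right p
    simp only [peripheral]
    rw [← mul_assoc, ← mul_assoc, hc.eq, hc.inv_left.eq, mul_assoc, mul_assoc, add_comm,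
      sub_eq_neg_add, _root_.zpow_add, _root_.zpow_add, zpow_one, _root_.zpow_neg, zpow_one]
    exact ⟨rfl, rfl⟩
  have hrecq : ∀ p q : ℤ, φ (regFun irrCurve (peripheral p (q + 1))) +
      φ (regFun irrCurve (peripheral p (q - 1))) =
      (L + L⁻¹) * φ (regFun irrCurve (peripheral p q)) := by
    intro p q
    rw [← (hcomm p q).1, ← (hcomm p q).2, hadd, hl]
  have hrecp : ∀ p q : ℤ, φ (regFun irrCurve (peripheral (p + 1) q)) +
      φ (regFun irrCurve (peripheral (p - 1) q)) =
      (M + M⁻¹) * φ (regFun irrCurve (peripheral p q)) := by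
    intro p q
    rw [← hα, ← hadd]
    simp only [peripheral]
    rw [← mul_assoc, ← mul_assoc, add_comm p 1, sub_eq_neg_add, _root_.zpow_add, _root_.zpow_add,
      zpow_one, _root_.zpow_neg, zpow_one]
  have e0 : ∀ q : ℤ, φ (regFun irrCurve (peripheral 0 q)) = 1 * L ^ q + 1 * (L ^ q)⁻¹ :=
    eq_zpow_of_recurrence h.longitude_ne_zero (hrecq 0) (by simpa [peripheral] using h1)
      (by simpa [peripheral] using hl)
  have e1 : ∀ q : ℤ, φ (regFun irrCurve (peripheral 1 q)) = M * L ^ q + M⁻¹ * (L ^ q)⁻¹ :=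
    eq_zpow_of_recurrence h.longitude_ne_zero (hrecq 1) (by simpa [peripheral] using hα)
      (by simpa [peripheral] using hαl)
  have e2 := eq_zpow_of_recurrence h.meridian_ne_zero (f := fun p =>
      φ (regFun irrCurve (peripheral p q))) (a := L ^ q) (b := (L ^ q)⁻¹) (fun p => hrecp p q)
    (by simpa using e0 q) (by rw [e1]; ring) p
  rw [e2, mul_inv]
  ring

end FigEight

/-! ### The places of the function field -/

namespace FigEight

/-- An injective homomorphism from the coordinate ring to a valued field gives a place. -/
theorem exists_place_of_algHom {S : Set (KnotGroup → ℂ)} [IsDomain (coordRing S)] {K : Type}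
    [Field K] [Algebra ℂ K] {v : Valuation K ℤᵐ⁰} (hv : TrivialOnConst v)
    (φ : coordRing S →ₐ[ℂ] K) (hφ : Function.Injective φ) (hsurj : ∃ h, v (φ h) = exp 1) :
    ∃ P : Place (funField S), ∀ h : coordRing S,
      P.v (algebraMap (coordRing S) (funField S) h) = v (φ h) := by
  have hφ' : Function.Injective (φ : coordRing S →+* K) := hφ
  let ψ : funField S →+* K := IsFractionRing.lift hφ'
  have hψ : ∀ h : coordRing S, ψ (algebraMap (coordRing S) (funField S) h) = φ h :=
    fun h => IsFractionRing.lift_algebraMap hφ' h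
  refine ⟨⟨v.comap ψ, ?_, ?_⟩, fun h => ?_⟩
  · obtain ⟨h, hh⟩ := hsurj
    intro z
    by_cases hz : z = 0
    · exact ⟨0, by rw [map_zero, hz]⟩
    -- Powers of one element of value `exp 1` attain every nonzero value, so the pulled-back
    -- valuation is normalized.
    · refine ⟨algebraMap (coordRing S) (funField S) h ^ log z, ?_⟩
      rw [Valuation.comap_apply, map_zpow₀, map_zpow₀, hψ, hh, ← WithZero.exp_zsmul, smul_eq_mul, mul_one,
        exp_log hz]
  · intro c hc
    rw [IsScalarTower.algebraMap_apply ℂ (coordRing S) (funField S), Valuation.comap_apply, hψ,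
      AlgHom.commutes]
    exact hv c hc
  · rw [Valuation.comap_apply, hψ]

/-- The coordinate `u` as a rational function on the curve. -/
def ratU : funField irrCurve :=
  algebraMap (coordRing irrCurve) (funField irrCurve) (regU irrCurve)

theorem onCurve_traceFun : OnCurve (traceFun irrCurve α) ratU := by
  have := congrArg (algebraMap (coordRing irrCurve) (funField irrCurve)) onCurve_regFun
  simpa [OnCurve, traceFun, ratU, map_ofNat] using this

theorem algebraMap_aeval_regFun (P : MvPolynomial (Fin 2) ℂ) :
    algebraMap (coordRing irrCurve) (funField irrCurve)
      (MvPolynomial.aeval ![regFun irrCurve α, regU irrCurve] P) =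
      MvPolynomial.aeval ![traceFun irrCurve α, ratU] P :=
  algHom_aeval (IsScalarTower.toAlgHom ℂ (coordRing irrCurve) (funField irrCurve)) P

theorem generatedBy_traceFun : GeneratedBy (traceFun irrCurve α) ratU := by
  intro f
  obtain ⟨a, b, hb, rfl⟩ := IsFractionRing.div_surjective (A := coordRing irrCurve) f
  obtain ⟨P, rfl⟩ := aeval_coordRing_surjective irrCurve_subset a
  obtain ⟨Q, rfl⟩ := aeval_coordRing_surjective irrCurve_subset b
  have hQ : algebraMap (coordRing irrCurve) (funField irrCurve)
      (MvPolynomial.aeval ![regFun irrCurve α, regU irrCurve] Q) ≠ 0 :=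
    IsFractionRing.to_map_ne_zero_of_mem_nonZeroDivisors hb
  refine ⟨P, Q, ?_, ?_⟩
  · rwa [← algebraMap_aeval_regFun]
  · rw [← algebraMap_aeval_regFun, ← algebraMap_aeval_regFun, div_mul_cancel₀ _ hQ]

/-- If u is a unit at P, then x² = u⁻¹ + 3 + u is integral, hence so is every polynomial in x and u.
-/
theorem lt_one_of_isIdealPoint {P : Place (funField irrCurve)} (hP : IsIdealPoint irrCurve P) :
    P.v ratU < 1 ∨ P.v ratU⁻¹ < 1 := by
  have hv : TrivialOnConst P.v := P.trivial_const
  by_contra! hcon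
  have hu : P.v ratU = 1 := by
    refine le_antisymm ?_ hcon.1
    have h1 := hcon.2
    rw [map_inv₀] at h1
    exact (one_le_inv₀ (zero_lt_one.trans_le hcon.1)).mp h1
  obtain ⟨h, hh⟩ := hP
  obtain ⟨Q, rfl⟩ := aeval_coordRing_surjective irrCurve_subset h
  rw [algebraMap_aeval_regFun] at hh
  exact hh.not_ge (hv.map_mvAeval_le_one (hv.map_le_one_of_curve onCurve_traceFun hu) hu.le Q)

theorem poleOrder_eq_zero_of_not_isIdealPoint {P : Place (funField irrCurve)}
    (hP : ¬ IsIdealPoint irrCurve P) (g : KnotGroup) : P.poleOrder (fFun irrCurve g) = 0 := by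
  have h1 : P.v (fFun irrCurve g) ≤ 1 := by
    by_contra! h
    apply hP
    refine ⟨regFun irrCurve g ^ 2 - 4, ?_⟩
    rw [map_sub, map_pow, map_ofNat]
    exact h
  rw [Place.poleOrder, Int.toNat_eq_zero]
  by_cases h0 : P.v (fFun irrCurve g) = 0
  -- The zero function also gets pole order 0, since `log 0 = 0`; this covers p = q = 0.
  · rw [h0, log_zero]
  · rwa [log_le_iff_le_exp h0, exp_zero]

/-- Here (z + z⁻¹)² - 4 = (z - z⁻¹)², and for n ≠ 0 exactly one of z, z⁻¹ dominates. For n = 0 the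
difference is integral, possibly zero. -/
theorem toNat_log_valuation {K : Type} [Field K] (v : Valuation K ℤᵐ⁰) {z : K} {n : ℤ}
    (hz : v z = exp n) : (log (v ((z + z⁻¹) ^ 2 - 4))).toNat = 2 * n.natAbs := by
  have hz0 : z ≠ 0 := by
    rw [← v.ne_zero_iff, hz]
    exact exp_ne_zero
  have h1 : (z + z⁻¹) ^ 2 - 4 = (z - z⁻¹) ^ 2 := by
    field_simp
    ring
  have hi : v z⁻¹ = exp (-n) := by rw [map_inv₀, hz]; rfl
  have h2 : n ≠ 0 → v (z - z⁻¹) = exp |n| := by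
    intro hn
    rw [sub_eq_add_neg, v.map_add_of_distinct_val, v.map_neg, hz, hi, abs_eq_max_neg]
    · rcases le_total n (-n) with h | h
      · rw [max_eq_right h, max_eq_right (exp_le_exp.mpr h)]
      · rw [max_eq_left h, max_eq_left (exp_le_exp.mpr h)]
    · rw [v.map_neg, hz, hi, ne_eq, exp_inj]
      omega
  rw [h1, map_pow, log_pow, nsmul_eq_mul]
  by_cases hn : n = 0
  · subst hn
    have h3 : v (z - z⁻¹) ≤ 1 := v.map_sub_le hz.le hi.le
    have h4 : log (v (z - z⁻¹)) ≤ 0 := by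
      by_cases h0 : v (z - z⁻¹) = 0
      · rw [h0, log_zero]
      · rwa [log_le_iff_le_exp h0, exp_zero]
    push_cast
    omega
  · rw [h2 hn, log_exp, Int.abs_eq_natAbs]
    omega

/-- At a place given by an expansion with eigenvalues `M`, `L` of valuations `1` and `e`, the
function `f_{pα + qλ}` has a pole of order `2 |p + e q|`. -/
theorem exists_place_of_eigenvaluePoint {K : Type} [Field K] [Algebra ℂ K] {v : Valuation K ℤᵐ⁰}
    (hv : TrivialOnConst v) {x u M L : K} (h : IsEigenvaluePoint x u M L) {e : ℤ} (hu : v u ≠ 1)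
    (hM : v M = exp 1) (hL : v L = exp e) :
    ∃ P : Place (funField irrCurve), IsIdealPoint irrCurve P ∧ P.v ratU = v u ∧
      ∀ p q : ℤ, P.poleOrder (fFun irrCurve (peripheral p q)) = 2 * (p + e * q).natAbs := by
  obtain ⟨φ, hφ, hx, hu'⟩ := exists_eigenvalue_algHom hv h hu
  have hvx : v (φ (regFun irrCurve α)) = exp 1 := by
    rw [hx, h.trace_meridian, v.map_add_eq_of_lt_left, hM]
    rw [map_inv₀, hM, ← WithZero.exp_neg, exp_lt_exp]
    norm_num
  obtain ⟨P, hP⟩ := exists_place_of_algHom hv φ hφ ⟨_, hvx⟩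
  refine ⟨P, ⟨regFun irrCurve α, ?_⟩, by rw [ratU, hP, hu'], fun p q => ?_⟩
  · rw [hP, hvx, ← exp_zero, exp_lt_exp]
    norm_num
  · have h1 : fFun irrCurve (peripheral p q) = algebraMap (coordRing irrCurve) (funField irrCurve)
        (regFun irrCurve (peripheral p q) ^ 2 - 4) := by
      rw [map_sub, map_pow, map_ofNat]
      rfl
    rw [Place.poleOrder, h1, hP, map_sub, map_pow, map_ofNat,
      algHom_regFun_peripheral φ (M := M) (L := L) (by rwa [hx, hu']), toNat_log_valuation]
    rw [map_mul, map_zpow₀, map_zpow₀, hM, hL, ← WithZero.exp_zsmul, ← WithZero.exp_zsmul, ← WithZero.exp_add]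
    congr 1
    simp only [smul_eq_mul]
    ring

theorem exists_ideal_points : ∃ P Q : Place (funField irrCurve), P ≠ Q ∧
    (∀ R : Place (funField irrCurve), IsIdealPoint irrCurve R ↔ R = P ∨ R = Q) ∧
    ∀ p q : ℤ, P.poleOrder (fFun irrCurve (peripheral p q)) = 2 * (p + 4 * q).natAbs ∧
      Q.poleOrder (fFun irrCurve (peripheral p q)) = 2 * (p - 4 * q).natAbs := by
  obtain ⟨x, M, u₁, u₂, L₁, L₂, h₁, h₂, hM, hu₁, hu₂, hL₁, hL₂⟩ := exists_laurent_points
  obtain ⟨P, hP, hPu, hPf⟩ := exists_place_of_eigenvaluePoint trivialOnConst_laurentSeries h₂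
    (by rw [hu₂, ne_eq, exp_eq_one]; norm_num) hM hL₂
  obtain ⟨Q, hQ, hQu, hQf⟩ := exists_place_of_eigenvaluePoint trivialOnConst_laurentSeries h₁
    (by rw [hu₁, ne_eq, exp_eq_one]; norm_num) hM hL₁
  have hQ1 : Q.v ratU < 1 := by
    rw [hQu, hu₁, ← exp_zero, exp_lt_exp]
    norm_num
  have hP1 : P.v ratU⁻¹ < 1 := by
    rw [map_inv₀, hPu, hu₂, ← WithZero.exp_neg, ← exp_zero, exp_lt_exp]
    norm_num
  have hcurve' : OnCurve (traceFun irrCurve α) ratU⁻¹ := by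
    rw [onCurve_traceFun.inv_eq]
    exact onCurve_traceFun.symm
  refine ⟨P, Q, ?_, fun R => ⟨fun hR => ?_, ?_⟩, fun p q => ⟨hPf p q, ?_⟩⟩
  · rintro rfl
    rw [map_inv₀] at hP1
    exact hP1.not_gt ((one_lt_inv₀ (by rw [hPu, hu₂]; exact exp_pos)).mpr hQ1)
  · rcases lt_one_of_isIdealPoint hR with h | h
    · exact Or.inr (generatedBy_traceFun.place_unique onCurve_traceFun h hQ1)
    -- The pole of u is the zero of u⁻¹, and (x, u⁻¹) generates the field and lies on the same
    -- curve.
    · exact Or.inl ((generatedBy_traceFun.inv onCurve_traceFun).place_unique hcurve' h hP1)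
  · rintro (rfl | rfl)
    · exact hP
    · exact hQ
  · rw [hQf, neg_mul, ← sub_eq_add_neg]

end FigEight

/-! ### The main theorem -/

theorem mainTheorem6 :
    ∃ X₀ : Set (KnotGroup → ℂ),
      -- `X₀` is the unique component of `X(M)` with the character of an irreducible representation
      IsComponent X₀ ∧
      (∀ X : Set (KnotGroup → ℂ), IsComponent X →
        ((∃ ρ : KnotGroup →* SL2C, IsIrreducibleRep ρ ∧ character ρ ∈ X) ↔ X = X₀)) ∧
      -- `X₀` is the unique component with the character of the discrete faithful representation
      (∀ ρ₀ : KnotGroup →* SL2C, IsDiscreteFaithful ρ₀ →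
        ∀ X : Set (KnotGroup → ℂ), IsComponent X → (character ρ₀ ∈ X ↔ X = X₀)) ∧
      -- there are exactly two ideal points; the pole orders of `f_α` and `f_λ` are `2` and `8`
      {P : Place (funField X₀) | IsIdealPoint X₀ P}.encard = 2 ∧
      (∀ P : Place (funField X₀), IsIdealPoint X₀ P →
        P.poleOrder (fFun X₀ α) = 2 ∧ P.poleOrder (fFun X₀ longitude) = 8) ∧
      -- the Culler–Shalen norm
      ∀ p q : ℤ,
        csNorm X₀ p q = ((2 * ((p + 4 * q).natAbs + (p - 4 * q).natAbs) : ℕ) : ℕ∞) := by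
  obtain ⟨P, Q, hPQ, hideal, hpole⟩ := exists_ideal_points
  refine ⟨irrCurve, isComponent_irrCurve, fun X hX => ⟨?_, ?_⟩, fun ρ hρ X hX => ⟨fun h => ?_, ?_⟩,
    ?_, fun R hR => ?_, fun p q => ?_⟩
  · rintro ⟨ρ, hρ, hmem⟩
    exact IsComponent.eq_irrCurve hX hρ hmem
  · rintro rfl
    exact exists_irreducible_mem_irrCurve
  · exact IsComponent.eq_irrCurve hX (isIrreducibleRep_of_isDiscreteFaithful hρ) h
  · rintro rfl
    exact mem_irrCurve_of_isIrreducibleRep (isIrreducibleRep_of_isDiscreteFaithful hρ)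
  · have : {R : Place (funField irrCurve) | IsIdealPoint irrCurve R} = {P, Q} := Set.ext hideal
    rw [this, Set.encard_pair hPQ]
  · have hα : α = peripheral 1 0 := by simp [peripheral]
    have hl : longitude = peripheral 0 1 := by simp [peripheral]
    rw [hl, hα]
    rcases (hideal R).mp hR with rfl | rfl
    · exact ⟨(hpole 1 0).1, (hpole 0 1).1⟩
    · exact ⟨(hpole 1 0).2, (hpole 0 1).2⟩
  · classical
    -- The sum over all places reduces to the ideal points, as f_γ is regular at every other place.
    rw [csNorm, degree, tsum_eq_sum (s := {P, Q}), Finset.sum_pair hPQ, (hpole p q).1,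
      (hpole p q).2]
    · push_cast
      ring
    · intro R hR
      rw [poleOrder_eq_zero_of_not_isIdealPoint, Nat.cast_zero]
      intro hR'
      rw [hideal] at hR'
      simp [hR'] at hR
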